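/- Let $(M^n,g_M)$ be a connected (smooth) Riemannian manifold, let $\mathcal H:\mathbb R\times M\to\mathbb R$ be smooth, and let $\overline M^{n+2}=\mathbb R^2\times M^n$ be the plane fronted wave with the Lorentzian metric $$\langle\ ,\ \rangle=\mathcal H(u,x)\,du\otimes du+du\otimes dv+dv\otimes du+g_M ,$$ where $(u,v)$ are the natural coordinates on $\mathbb R^2$. Call a Riemannian manifold \emph{parabolic} if it is complete and every ($C^2$) function $f$ on it with $\Delta f\le 0$ that is bounded from below is constant, where $\Delta=\operatorname{div}\nabla$ (compact manifolds are allowed). Let $\psi:\Sigma^k\to\overline M^{n+2}$ be a connected spacelike submanifold, i.e. a smooth immersion of a connected manifold whose induced metric is Riemannian, let $\overrightarrow H=\frac1k\operatorname{trace}(\mathrm{II})$ be its mean curvature vector field, put $\mu=u\circ\psi$, and assume that $\Sigma^k$ with the induced metric is parabolic. If $\langle\overrightarrow H,\partial_v\rangle\ge 0$ on $\Sigma^k$ and $\sup_{\Sigma^k}\mu<+\infty$, or if $\langle\overrightarrow H,\partial_v\rangle\le 0$ on $\Sigma^k$ and $\inf_{\Sigma^k}\mu>-\infty$, then $\mu$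 is constant, $\mu=u_0$ for some $u_0\in\mathbb R$. If in addition $k=n$ (codimension two) and $\Sigma^n$ is simply connected, then for every $v_0\in\mathbb R$ the wavefront $\{u=u_0,\ v=v_0\}$, with its induced metric, is parabolic. -/

import Mathlib

open Set Filter Topology Bundle
open scoped Manifold ContDiff ENNReal

noncomputable section

namespace PlaneFrontedWave

section General

variable {E : Type*} [NormedAddCommGroup E] [NormedSpace ℝ E] [FiniteDimensional ℝ E]
  {H : Type*} [TopologicalSpace H]
  {E' : Type*} [NormedAddCommGroup E'] [NormedSpace ℝ E'] [FiniteDimensional ℝ E']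
  {H' : Type*} [TopologicalSpace H']

/-- A field of (semi-Riemannian) inner products `g x a b = ⟨a, b⟩_x` on the tangent spaces. -/
abbrev MetricField (I : ModelWithCorners ℝ E H) (M : Type*) [TopologicalSpace M]
    [ChartedSpace H M] : Type _ :=
  ∀ x : M, TangentSpace I x → TangentSpace I x → ℝ

/-- The inverse Gram matrix `(g^{ij})` of a bilinear form in a fixed basis of `E`. -/
def invGram (B : E → E → ℝ) :
    Matrix (Fin (Module.finrank ℝ E)) (Fin (Module.finrank ℝ E)) ℝ :=
  (Matrix.of fun i j => B (Module.finBasis ℝ E i) (Module.finBasis ℝ E j))⁻¹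

/-- The metric trace `∑ g^{ij} S(e_i, e_j)` of a (possibly vector-valued) bilinear map `S`. -/
def metricTrace {F : Type*} [AddCommGroup F] [Module ℝ F] (B : E → E → ℝ) (S : E → E → F) : F :=
  ∑ i, ∑ j, invGram B i j • S (Module.finBasis ℝ E i) (Module.finBasis ℝ E j)

variable {I : ModelWithCorners ℝ E H} {I' : ModelWithCorners ℝ E' H'}
  {M : Type*} [TopologicalSpace M] [ChartedSpace H M]
  {M' : Type*} [TopologicalSpace M'] [ChartedSpace H' M']

/-- The components of the metric `g` in the preferred chart at `p`, as a function of the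
coordinates `y`. -/
def metricInChart (g : MetricField I M) (p : M) (y : E) (a b : E) : ℝ :=
  g ((extChartAt I p).symm y)
    (mfderiv 𝓘(ℝ, E) I (extChartAt I p).symm y a)
    (mfderiv 𝓘(ℝ, E) I (extChartAt I p).symm y b)

/-- The Christoffel symbol of the first kind at `p`, in the preferred chart at `p`:
`½ (∂_a g(b, c) + ∂_b g(a, c) - ∂_c g(a, b))`. -/
def christoffelFirst (g : MetricField I M) (p : M) (a b c : E) : ℝ :=
  (fderiv ℝ (fun y => metricInChart g p y b c) (extChartAt I p p) a
    + fderiv ℝ (fun y => metricInChart g p y a c) (extChartAt I p p) b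
    - fderiv ℝ (fun y => metricInChart g p y a b) (extChartAt I p p) c) / 2

/-- The Christoffel symbol (of the second kind) of the Levi-Civita connection of `g` at `p`, in
the preferred chart at `p`: the value at `p` of `∇_a b`, where `a` and `b` are extended to fields
with constant components in this chart. It is
`Γ(a, b) = ∑ g^{ij} Γ(a, b; e_j) e_i`. -/
def christoffel (g : MetricField I M) (p : M) (a b : E) : E :=
  ∑ i, ∑ j, (invGram (metricInChart g p (extChartAt I p p)) i j
    * christoffelFirst g p a b (Module.finBasis ℝ E j)) • Module.finBasis ℝ E i

/-- The second derivative at `p` of a map between manifolds, written in the preferred charts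
at `p` and at `ψ p`. -/
def secondDerivInChart (I : ModelWithCorners ℝ E H) (I' : ModelWithCorners ℝ E' H')
    (ψ : M → M') (p : M) (a b : E) : E' :=
  fderiv ℝ (fun y => fderiv ℝ (writtenInExtChartAt I I' p ψ) y b) (extChartAt I p p) a

/-- The Hessian `∇df` of a function on a manifold with a metric. -/
def hessian (g : MetricField I M) (f : M → ℝ) (p : M) (a b : TangentSpace I p) : ℝ :=
  let df : E → ℝ := mfderiv I 𝓘(ℝ, ℝ) f p
  secondDerivInChart (E := E) (E' := ℝ) I 𝓘(ℝ, ℝ) f p a b - df (christoffel (E := E) g p a b)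

/-- The Laplacian `Δf = div (grad f) = trace (∇df)`. -/
def laplacian (g : MetricField I M) (f : M → ℝ) (p : M) : ℝ :=
  metricTrace (E := E) (g p) (hessian g f p)

/-- The metric induced on `M` by a map `ψ : M → M'` into a manifold with metric `g'`. -/
def inducedMetric (I : ModelWithCorners ℝ E H) (g' : MetricField I' M') (ψ : M → M') :
    MetricField I M :=
  fun p a b => g' (ψ p) (mfderiv I I' ψ p a) (mfderiv I I' ψ p b)

/-- A spacelike submanifold: a smooth immersion whose induced metric is Riemannian. -/
structure IsSpacelikeSubmanifold (I : ModelWithCorners ℝ E H) (g' : MetricField I' M')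
    (ψ : M → M') : Prop where
  contMDiff : ContMDiff I I' ∞ ψ
  immersion : ∀ p, Function.Injective (mfderiv I I' ψ p)
  spacelike : ∀ (p : M) (a : TangentSpace I p), a ≠ 0 → 0 < inducedMetric I g' ψ p a a

/-- The ambient covariant derivative at `p` along `ψ`: the value at `p` of `∇̄_a (dψ b)`, where `b`
is extended to the field with constant components in the preferred chart at `p`. -/
def ambientCovDeriv (I : ModelWithCorners ℝ E H) (g' : MetricField I' M') (ψ : M → M') (p : M)
    (a b : TangentSpace I p) : TangentSpace I' (ψ p) :=
  secondDerivInChart (E := E) (E' := E') I I' ψ p a b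
    + christoffel (E := E') g' (ψ p) (mfderiv I I' ψ p a) (mfderiv I I' ψ p b)

/-- The second fundamental form, from the Gauss formula: `II(a, b) = ∇̄_a b - ∇_a b`, with `∇̄` and
`∇` the Levi-Civita connections of the ambient metric and of the induced metric. -/
def secondFundamentalForm (I : ModelWithCorners ℝ E H) (g' : MetricField I' M') (ψ : M → M')
    (p : M) (a b : TangentSpace I p) : TangentSpace I' (ψ p) :=
  ambientCovDeriv I g' ψ p a b - mfderiv I I' ψ p (christoffel (E := E) (inducedMetric I g' ψ) p a b)

/-- The mean curvature vector `(1/k) trace II`, where `k` is the dimension of the submanifold. -/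
def meanCurvature (I : ModelWithCorners ℝ E H) (g' : MetricField I' M') (ψ : M → M') (p : M) :
    TangentSpace I' (ψ p) :=
  (1 / (Module.finrank ℝ E : ℝ)) •
    metricTrace (E := E) (inducedMetric I g' ψ p) (secondFundamentalForm I g' ψ p)

/-- The Riemannian distance: the infimum of the lengths of `C^1` paths, where the length of a
tangent vector is `√(g(a, a))`. -/
def riemDist (g : MetricField I M) (x y : M) : ℝ≥0∞ :=
  letI : ∀ z : M, ENorm (TangentSpace I z) := fun z => ⟨fun a => ENNReal.ofReal √(g z a a)⟩
  Manifold.riemannianEDist I x y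

/-- Completeness for the Riemannian distance: every Cauchy sequence converges. -/
def IsCompleteMetric (g : MetricField I M) : Prop :=
  ∀ s : ℕ → M,
    (∀ ε : ℝ≥0∞, 0 < ε → ∃ N, ∀ i j, N ≤ i → N ≤ j → riemDist g (s i) (s j) < ε) →
    ∃ x, Tendsto (fun i => riemDist g (s i) x) atTop (𝓝 0)

/-- Parabolicity: the metric is complete, and every superharmonic function bounded from below is
constant. (Every compact manifold is then parabolic.) -/
structure IsParabolic (g : MetricField I M) : Prop where
  complete : IsCompleteMetric g
  eq_const : ∀ f : M → ℝ, ContMDiff I 𝓘(ℝ, ℝ) 2 f → (∀ x, laplacian g f x ≤ 0) →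
    BddBelow (range f) → ∃ c, ∀ x, f x = c

end General

section Wave

variable {n : ℕ} {M : Type*} [TopologicalSpace M] [ChartedSpace (EuclideanSpace ℝ (Fin n)) M]

/-- The model with corners of `ℝ² × M`. -/
abbrev waveModel (n : ℕ) : ModelWithCorners ℝ ((ℝ × ℝ) × EuclideanSpace ℝ (Fin n))
    (ModelProd (ℝ × ℝ) (EuclideanSpace ℝ (Fin n))) :=
  𝓘(ℝ, ℝ × ℝ).prod (𝓡 n)

/-- The metric `𝓗(u, x) du ⊗ du + du ⊗ dv + dv ⊗ du + g_M` of a plane fronted wave, at the point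
`((u, v), x)` of `ℝ² × M`. The tangent space is `(ℝ × ℝ) × T_x M`, with `a.1.1 = du(a)` and
`a.1.2 = dv(a)`. -/
def waveMetric [IsManifold (𝓡 n) ∞ M]
    (gM : ContMDiffRiemannianMetric (𝓡 n) ∞ (EuclideanSpace ℝ (Fin n))
      (TangentSpace (𝓡 n) : M → Type _))
    (𝓗 : ℝ × M → ℝ) : MetricField (waveModel n) ((ℝ × ℝ) × M) :=
  fun q (a b : (ℝ × ℝ) × EuclideanSpace ℝ (Fin n)) =>
    𝓗 (q.1.1, q.2) * a.1.1 * b.1.1 + a.1.1 * b.1.2 + a.1.2 * b.1.1 + gM.inner q.2 a.2 b.2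

/-- The coordinate vector field `∂_v`. -/
def partialV (q : (ℝ × ℝ) × M) : TangentSpace (waveModel n) q :=
  (((0, 1), 0) : (ℝ × ℝ) × EuclideanSpace ℝ (Fin n))

/-- The wavefront `u = u₀`, `v = v₀`, as an embedding of `M`. -/
def wavefront (u₀ v₀ : ℝ) (x : M) : (ℝ × ℝ) × M := ((u₀, v₀), x)

end Wave

end PlaneFrontedWave

end

/-! The field `∂_v` is null and parallel, and its metric dual is `du`. Projecting the Gauss formula
on `∂_v` therefore gives `Hess μ = ⟨II, ∂_v⟩`, and tracing gives `Δμ = k ⟨H, ∂_v⟩` (`hessian_du`,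
`laplacian_du`, resting on `duCLM_christoffel_waveMetric`). Under either hypothesis one of `μ`, `-μ`
is superharmonic and bounded from below, so parabolicity makes `μ` constant.

Once `μ = u₀`, every term of the wave metric containing `du` vanishes along the submanifold. The
induced metric is then the pullback of `g_M` by the projection `φ` of `ψ` to `M`
(`inducedMetric_waveMetric_of_const`). In codimension two `φ` is a local isometry between manifolds
of equal dimension, and a wavefront is isometric to `M` itself. It remains to push parabolicity
forward along `φ` (`isParabolic_of_inducedMetric`).

Since the source is complete, the endpoint of a path of finite length in `M` lifts, at a distance at
most the length of the path (`exists_lift_endpoint`). As `M` is connected, all its distances are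
finite, so `φ` is onto. Cauchy sequences of `M` then lift too, up to a subsequence, which makes `M`
complete. Finally the Laplacian commutes with pullback by a local isometry
(`IsChartMetric.laplacian_inducedMetric`), so a superharmonic function on `M` bounded from below
pulls back to a constant, and is constant because `φ` is onto. -/

noncomputable section

namespace PlaneFrontedWave

/-! ### Lengths, distances and path lifting through local isometries. -/

section Length

variable {E : Type*} [NormedAddCommGroup E] [NormedSpace ℝ E]
  {H : Type*} [TopologicalSpace H]
  {E' : Type*} [NormedAddCommGroup E'] [NormedSpace ℝ E']
  {H' : Type*} [TopologicalSpace H']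
  {I : ModelWithCorners ℝ E H} {I' : ModelWithCorners ℝ E' H'}
  {M : Type*} [TopologicalSpace M] [ChartedSpace H M]
  {M' : Type*} [TopologicalSpace M'] [ChartedSpace H' M']

/-- The homogeneity of degree two of the quadratic forms `a ↦ g(a, a)`. -/
def IsQuadratic (g : MetricField I M) : Prop :=
  ∀ (x : M) (c : ℝ) (a : TangentSpace I x), g x (c • a) (c • a) = c ^ 2 * g x a a

/-- The length of tangent vectors for a metric. -/
abbrev metricENorm (g : MetricField I M) (z : M) : ENorm (TangentSpace I z) :=
  ⟨fun a => ENNReal.ofReal √(g z a a)⟩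

/-- The length of a path for a metric. -/
def metricLength (g : MetricField I M) (γ : ℝ → M) (a b : ℝ) : ℝ≥0∞ :=
  letI := metricENorm g
  Manifold.pathELength I γ a b

/-- Homogeneity of the speed is what reparametrisation of paths requires; neither positivity nor
bilinearity of `g` enters the distance inequalities below. -/
theorem metricENorm_smulClass {g : MetricField I M} (hg : IsQuadratic g) (z : M) :
    letI := metricENorm g z
    ENormSMulClass ℝ (TangentSpace I z) := by
  let _ := metricENorm g z
  refine ⟨fun c a => ?_⟩
  change ENNReal.ofReal √(g z (c • a) (c • a)) = ‖c‖ₑ * ENNReal.ofReal √(g z a a)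
  rw [hg z c a, Real.sqrt_mul (sq_nonneg c), Real.sqrt_sq_eq_abs,
    ENNReal.ofReal_mul (abs_nonneg c), ← Real.enorm_eq_ofReal_abs]

theorem metricLength_add (g : MetricField I M) (γ : ℝ → M) {a b c : ℝ} (h : a ≤ b) (h' : b ≤ c) :
    metricLength g γ a b + metricLength g γ b c = metricLength g γ a c := by
  let _ := metricENorm g
  exact Manifold.pathELength_add h h'

theorem metricLength_mono (g : MetricField I M) (γ : ℝ → M) {a b a' b' : ℝ} (h : a' ≤ a)
    (h' : b ≤ b') : metricLength g γ a b ≤ metricLength g γ a' b' := by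
  let _ := metricENorm g
  exact Manifold.pathELength_mono h h'

theorem riemDist_le_metricLength {g : MetricField I M} (hg : IsQuadratic g) {γ : ℝ → M} {a b : ℝ}
    (hγ : ContMDiffOn 𝓘(ℝ, ℝ) I 1 γ (Icc a b)) (hab : a ≤ b) :
    riemDist g (γ a) (γ b) ≤ metricLength g γ a b := by
  let _ := metricENorm g
  have _ := metricENorm_smulClass hg
  exact Manifold.riemannianEDist_le_pathELength hγ rfl rfl hab

theorem exists_path_of_riemDist_lt {g : MetricField I M} {x y : M} {r : ℝ≥0∞}
    (h : riemDist g x y < r) :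
    ∃ γ : ℝ → M, γ 0 = x ∧ γ 1 = y ∧ ContMDiffOn 𝓘(ℝ, ℝ) I 1 γ (Icc 0 1) ∧
      metricLength g γ 0 1 < r := by
  let _ := metricENorm g
  exact Manifold.exists_lt_of_riemannianEDist_lt h

theorem riemDist_self {g : MetricField I M} (hg : IsQuadratic g) (x : M) : riemDist g x x = 0 := by
  let _ := metricENorm g
  have _ := metricENorm_smulClass hg
  exact Manifold.riemannianEDist_self

theorem riemDist_comm {g : MetricField I M} (hg : IsQuadratic g) (x y : M) :
    riemDist g x y = riemDist g y x := by
  let _ := metricENorm g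
  have _ := metricENorm_smulClass hg
  exact Manifold.riemannianEDist_comm

theorem riemDist_triangle {g : MetricField I M} (hg : IsQuadratic g) (x y z : M) :
    riemDist g x z ≤ riemDist g x y + riemDist g y z := by
  let _ := metricENorm g
  have _ := metricENorm_smulClass hg
  exact Manifold.riemannianEDist_triangle

theorem inducedMetric_isQuadratic {g' : MetricField I' M'} (hg : IsQuadratic g') (φ : M → M') :
    IsQuadratic (inducedMetric I g' φ) := by
  intro x c a
  simp only [inducedMetric, map_smul]
  exact hg _ _ _

/-- A path and its image have the same length, for the induced metric. -/
theorem metricLength_comp (g' : MetricField I' M') {φ : M → M'} {γ : ℝ → M} {a b : ℝ}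
    (hφ : ∀ t ∈ Ioo a b, MDifferentiableAt I I' φ (γ t))
    (hγ : ∀ t ∈ Ioo a b, MDifferentiableAt 𝓘(ℝ, ℝ) I γ t) :
    metricLength g' (φ ∘ γ) a b = metricLength (inducedMetric I g' φ) γ a b := by
  let _ := metricENorm g'
  let _ := metricENorm (inducedMetric I g' φ)
  unfold metricLength
  rw [Manifold.pathELength_eq_lintegral_mfderiv_Ioo, Manifold.pathELength_eq_lintegral_mfderiv_Ioo]
  refine MeasureTheory.setLIntegral_congr_fun measurableSet_Ioo fun t ht => ?_
  have := mfderiv_comp t (hφ t ht) (hγ t ht)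
  simp only [this]
  rfl

theorem mdifferentiableAt_of_contMDiffOn_Icc {γ : ℝ → M} {a b : ℝ}
    (hγ : ContMDiffOn 𝓘(ℝ, ℝ) I 1 γ (Icc a b)) {t : ℝ} (ht : t ∈ Ioo a b) :
    MDifferentiableAt 𝓘(ℝ, ℝ) I γ t :=
  ((hγ t ⟨ht.1.le, ht.2.le⟩).contMDiffAt (Icc_mem_nhds ht.1 ht.2)).mdifferentiableAt one_ne_zero

/-- An almost shortest path upstairs projects to a path of the same length. -/
theorem riemDist_le_of_inducedMetric {g' : MetricField I' M'} (hg : IsQuadratic g') {φ : M → M'}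
    (hφ : ContMDiff I I' 1 φ) (p q : M) :
    riemDist g' (φ p) (φ q) ≤ riemDist (inducedMetric I g' φ) p q := by
  refine le_of_forall_gt fun r hr => ?_
  obtain ⟨γ, h0, h1, hγ, hl⟩ := exists_path_of_riemDist_lt hr
  have := riemDist_le_metricLength hg (γ := φ ∘ γ) (hφ.comp_contMDiffOn hγ) zero_le_one
  simp only [Function.comp_apply, h0, h1] at this
  refine this.trans_lt ?_
  rwa [metricLength_comp g' (fun t _ => hφ.mdifferentiableAt one_ne_zero)
    fun t ht => mdifferentiableAt_of_contMDiffOn_Icc hγ ht]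

/-- A map with local `C^1` sections everywhere. -/
def HasLocalSections (I : ModelWithCorners ℝ E H) (I' : ModelWithCorners ℝ E' H')
    (φ : M → M') : Prop :=
  ∀ q : M, ∃ σ : M' → M, ∃ U ∈ 𝓝 (φ q), ContMDiffOn I' I 1 σ U ∧ σ (φ q) = q ∧
    ∀ y ∈ U, φ (σ y) = y

/-- A path can be followed for a short time by a path upstairs of the same length. -/
theorem exists_lift_step {g' : MetricField I' M'} (hg : IsQuadratic g') {φ : M → M'}
    (hφ : ContMDiff I I' 1 φ) (hsec : HasLocalSections I I' φ) {γ : ℝ → M'} {b t : ℝ}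
    (hγ : ContMDiffOn 𝓘(ℝ, ℝ) I' 1 γ (Icc 0 b)) (h0 : 0 ≤ t) (htb : t < b) {q : M}
    (hq : φ q = γ t) :
    ∃ t' q', t < t' ∧ t' ≤ b ∧ φ q' = γ t' ∧
      riemDist (inducedMetric I g' φ) q q' ≤ metricLength g' γ t t' := by
  obtain ⟨σ, U, hU, hσ, hσq, hσU⟩ := hsec q
  rw [hq] at hU hσq
  have hsub : Icc t b ⊆ Icc 0 b := Icc_subset_Icc_left h0
  have hc : ContinuousWithinAt γ (Icc t b) t :=
    ((hγ.mono hsub).continuousOn) t (left_mem_Icc.2 htb.le)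
  have hmem : {s | γ s ∈ U} ∈ 𝓝[≥] t := by
    have := hc hU
    rwa [nhdsWithin_Icc_eq_nhdsGE htb] at this
  obtain ⟨t₁, ht₁, hUt⟩ := mem_nhdsGE_iff_exists_Icc_subset.1 hmem
  set t' := min t₁ b with ht'
  have htt' : t < t' := lt_min ht₁ htb
  have hU' : ∀ s ∈ Icc t t', γ s ∈ U := fun s hs => hUt ⟨hs.1, hs.2.trans (min_le_left _ _)⟩
  have hγ' : ContMDiffOn 𝓘(ℝ, ℝ) I' 1 γ (Icc t t') :=
    hγ.mono fun s hs => ⟨h0.trans hs.1, hs.2.trans (min_le_right _ _)⟩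
  have hσγ : ContMDiffOn 𝓘(ℝ, ℝ) I 1 (σ ∘ γ) (Icc t t') := hσ.comp hγ' hU'
  refine ⟨t', σ (γ t'), htt', min_le_right _ _, hσU _ (hU' _ (right_mem_Icc.2 htt'.le)), ?_⟩
  have h1 := riemDist_le_metricLength (inducedMetric_isQuadratic (I := I) hg φ) hσγ htt'.le
  rw [← metricLength_comp g' (fun s _ => hφ.mdifferentiableAt one_ne_zero)
    fun s hs => mdifferentiableAt_of_contMDiffOn_Icc hσγ hs] at h1
  -- The section undoes `φ`, so the projected lift is `γ` itself and the lift has the length of `γ`.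
  have h2 : metricLength g' (φ ∘ σ ∘ γ) t t' = metricLength g' γ t t' := by
    let _ := metricENorm g'
    exact Manifold.pathELength_congr fun s hs => hσU _ (hU' s hs)
  rwa [h2, Function.comp_apply, Function.comp_apply, hσq] at h1

/-- Path lifting through a local isometry with complete source: the endpoint of a lift. -/
theorem exists_lift_endpoint {g' : MetricField I' M'} (hg : IsQuadratic g') {φ : M → M'}
    (hφ : ContMDiff I I' 1 φ) (hsec : HasLocalSections I I' φ)
    (hcomp : IsCompleteMetric (inducedMetric I g' φ))
    (hsep : ∀ (s : ℕ → M') (y z : M'), Tendsto s atTop (𝓝 y) →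
      Tendsto (fun i => riemDist g' (s i) z) atTop (𝓝 0) → z = y)
    {γ : ℝ → M'} (hγ : ContMDiffOn 𝓘(ℝ, ℝ) I' 1 γ (Icc 0 1))
    (hfin : metricLength g' γ 0 1 ≠ ⊤) {p : M} (hp : φ p = γ 0) :
    ∃ q, φ q = γ 1 ∧ riemDist (inducedMetric I g' φ) p q ≤ metricLength g' γ 0 1 := by
  set g := inducedMetric I g' φ with hgdef
  have hgq : IsQuadratic g := inducedMetric_isQuadratic (I := I) hg φ
  -- Zorn's lemma is applied to candidate endpoints (time, point above `γ`) instead of partial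
  -- lifts. Bounding distances upstairs by lengths downstairs is enough, and no lifted paths have to
  -- be glued.
  let X := {x : ℝ × M // x.1 ∈ Icc (0 : ℝ) 1 ∧ φ x.2 = γ x.1 ∧
    riemDist g p x.2 ≤ metricLength g' γ 0 x.1}
  let r : X → X → Prop := fun x y =>
    x.1.1 ≤ y.1.1 ∧ riemDist g x.1.2 y.1.2 ≤ metricLength g' γ x.1.1 y.1.1
  have hrefl : ∀ x, r x x := fun x => ⟨le_rfl, by rw [riemDist_self hgq]; exact zero_le⟩
  have htrans : ∀ {x y z : X}, r x y → r y z → r x z := fun {x y z} h h' =>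
    ⟨h.1.trans h'.1, (riemDist_triangle hgq _ y.1.2 _).trans
      ((add_le_add h.2 h'.2).trans_eq (metricLength_add g' γ h.1 h'.1))⟩
  have hchain : ∀ c : Set X, IsChain r c → ∃ ub, ∀ a ∈ c, r a ub := by
    intro c hc
    rcases c.eq_empty_or_nonempty with rfl | hne
    · refine ⟨⟨(0, p), ⟨le_rfl, zero_le_one⟩, hp, ?_⟩, by simp⟩
      simp only [riemDist_self hgq]
      exact zero_le
    let T : Set ℝ := (fun x : X => x.1.1) '' c
    have hTne : T.Nonempty := hne.image _
    have hTb : BddAbove T := ⟨1, by rintro _ ⟨x, -, rfl⟩; exact x.2.1.2⟩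
    have hlub := isLUB_csSup hTne hTb
    set t := sSup T
    by_cases htT : t ∈ T
    · obtain ⟨x, hx, hxt⟩ := htT
      refine ⟨x, fun a ha => ?_⟩
      by_cases hax : a = x
      · exact hax ▸ hrefl a
      rcases hc ha hx hax with h | h
      · exact h
      -- `x` already has the largest time in `c`, so a comparison in the wrong direction happens
      -- only at equal times, where symmetry of the distance reverses it.
      · have hle : a.1.1 ≤ x.1.1 := (hlub.1 ⟨a, ha, rfl⟩).trans_eq hxt.symm
        have heq : a.1.1 = x.1.1 := le_antisymm hle h.1
        refine ⟨hle, ?_⟩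
        rw [riemDist_comm hgq]
        simpa only [heq] using h.2
    · obtain ⟨u, hu, hut, hulim, huT⟩ := hlub.exists_seq_strictMono_tendsto_of_notMem htT hTne
      choose x hxc hxu using huT
      have ht1 : t ≤ 1 := hlub.2 (by rintro _ ⟨x, -, rfl⟩; exact x.2.1.2)
      have hmono : ∀ a ∈ c, ∀ b ∈ c, a.1.1 < b.1.1 → r a b := by
        intro a ha b hb hab
        rcases hc ha hb (fun h => by simp [h] at hab) with h | h
        · exact h
        · exact absurd h.1 (not_le.2 hab)
      have hr : ∀ i j, i ≤ j → r (x i) (x j) := by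
        intro i j hij
        rcases hij.eq_or_lt with rfl | hij
        · exact hrefl _
        · refine hmono _ (hxc i) _ (hxc j) ?_
          have := hu hij
          rwa [← hxu i, ← hxu j] at this
      have hx0 : ∀ i, 0 ≤ (x i).1.1 := fun i => (x i).2.1.1
      have hxt : ∀ i, (x i).1.1 < t := fun i => (hxu i).trans_lt (hut i)
      let ℓ : ℕ → ℝ≥0∞ := fun i => metricLength g' γ 0 (x i).1.1
      have hℓmono : Monotone ℓ := fun i j hij => metricLength_mono g' γ le_rfl (hr i j hij).1
      have hℓle : ∀ i, ℓ i ≤ metricLength g' γ 0 1 := fun i =>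
        metricLength_mono g' γ le_rfl (x i).2.1.2
      have hℓtop : ∀ i, ℓ i ≠ ⊤ := fun i => ne_top_of_le_ne_top hfin (hℓle i)
      have hsup : (⨆ i, ℓ i) ≠ ⊤ := ne_top_of_le_ne_top hfin (iSup_le hℓle)
      -- The lengths `ℓ i` increase to a finite supremum, and their increments bound the distances
      -- upstairs.
      have hcauchy : ∀ ε : ℝ≥0∞, 0 < ε → ∃ N, ∀ i j, N ≤ i → i ≤ j →
          riemDist g (x i).1.2 (x j).1.2 < ε := by
        intro ε hε
        -- Subtracting `ε` lowers the supremum strictly only if it is nonzero; if it is zero, all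
        -- these distances vanish.
        rcases eq_or_ne (⨆ i, ℓ i) 0 with h0 | h0
        · refine ⟨0, fun i j _ hij => lt_of_le_of_lt ((hr i j hij).2.trans ?_) hε⟩
          calc metricLength g' γ (x i).1.1 (x j).1.1 ≤ ℓ j := metricLength_mono g' γ (hx0 i) le_rfl
            _ ≤ ⨆ i, ℓ i := le_iSup ℓ j
            _ = 0 := h0
        obtain ⟨N, hN⟩ := lt_iSup_iff.1 (ENNReal.sub_lt_self hsup h0 hε.ne')
        refine ⟨N, fun i j hi hij => (hr i j hij).2.trans_lt ?_⟩
        have h1 : ℓ i + metricLength g' γ (x i).1.1 (x j).1.1 = ℓ j :=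
          metricLength_add g' γ (hx0 i) (hr i j hij).1
        have h2 : (⨆ i, ℓ i) < ℓ i + ε :=
          by
          by_contra! hcon
          exact absurd (hN.trans_le (hℓmono hi))
            (not_lt.2 (ENNReal.le_sub_of_add_le_right (ne_top_of_le_ne_top hsup
              (le_add_self.trans hcon)) hcon))
        exact (ENNReal.add_lt_add_iff_left (hℓtop i)).1
          (h1.trans_lt ((le_iSup ℓ j).trans_lt h2))
      obtain ⟨q, hq⟩ := hcomp (fun i => (x i).1.2) (by
        intro ε hε
        obtain ⟨N, hN⟩ := hcauchy ε hε
        refine ⟨N, fun i j hi hj => ?_⟩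
        rcases le_total i j with h | h
        · exact hN i j hi h
        · rw [riemDist_comm hgq]
          exact hN j i hj h)
      have ht0 : 0 ≤ t := (hx0 0).trans (hxt 0).le
      -- The points `γ (x i).1.1` tend to `γ t` in the topology and to `φ q` in distance; `hsep`
      -- identifies the two limits.
      have hφq : φ q = γ t := by
        refine hsep (fun i => γ (x i).1.1) _ _ ?_ ?_
        · refine ((hγ.continuousOn t ⟨ht0, ht1⟩).tendsto).comp ?_
          refine tendsto_nhdsWithin_iff.2 ⟨?_, Eventually.of_forall fun i => (x i).2.1⟩
          simpa only [hxu] using hulim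
        · refine tendsto_of_tendsto_of_tendsto_of_le_of_le tendsto_const_nhds hq
            (fun _ => zero_le) fun i => ?_
          have := riemDist_le_of_inducedMetric (I := I) hg hφ (x i).1.2 q
          rwa [(x i).2.2.1] at this
      have hlim : ∀ a ∈ c, riemDist g a.1.2 q ≤ metricLength g' γ a.1.1 t := by
        intro a ha
        have hat : a.1.1 < t := lt_of_le_of_ne (hlub.1 ⟨a, ha, rfl⟩)
          (fun h => htT (h ▸ ⟨a, ha, rfl⟩))
        have hlim' : Tendsto (fun i => metricLength g' γ a.1.1 t + riemDist g (x i).1.2 q) atTop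
            (𝓝 (metricLength g' γ a.1.1 t)) := by
          simpa using (tendsto_const_nhds (x := metricLength g' γ a.1.1 t)).add hq
        refine ge_of_tendsto hlim' ?_
        filter_upwards [hulim.eventually (lt_mem_nhds hat)] with i hi
        refine (riemDist_triangle hgq _ (x i).1.2 _).trans (add_le_add_left ?_ _)
        rw [← hxu i] at hi
        exact (hmono a ha _ (hxc i) hi).2.trans (metricLength_mono g' γ le_rfl (hxt i).le)
      refine ⟨⟨(t, q), ⟨ht0, ht1⟩, hφq, ?_⟩, fun a ha => ⟨hlub.1 ⟨a, ha, rfl⟩, hlim a ha⟩⟩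
      refine (riemDist_triangle hgq _ (x 0).1.2 _).trans
        ((add_le_add (x 0).2.2.2 (hlim _ (hxc 0))).trans_eq ?_)
      exact metricLength_add g' γ (hx0 0) (hxt 0).le
  obtain ⟨m, hm⟩ := exists_maximal_of_chains_bounded hchain htrans
  -- Before time 1 a maximal endpoint could still be advanced by `exists_lift_step`.
  have hm1 : m.1.1 = 1 := by
    by_contra hne
    obtain ⟨t', q', htt', ht'1, hq', hd⟩ := exists_lift_step hg hφ hsec hγ m.2.1.1
      (lt_of_le_of_ne m.2.1.2 hne) m.2.2.1
    have hpq : riemDist g p q' ≤ metricLength g' γ 0 t' :=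
      (riemDist_triangle hgq _ m.1.2 _).trans
        ((add_le_add m.2.2.2 hd).trans_eq (metricLength_add g' γ m.2.1.1 htt'.le))
    have := hm ⟨(t', q'), ⟨m.2.1.1.trans htt'.le, ht'1⟩, hq', hpq⟩ ⟨htt'.le, hd⟩
    exact absurd this.1 (not_le.2 htt')
  refine ⟨m.1.2, ?_, ?_⟩
  · rw [m.2.2.1, hm1]
  · simpa only [hm1] using m.2.2.2

/-- Distances lift through a local isometry with complete source. -/
theorem exists_lift_of_riemDist_lt {g' : MetricField I' M'} (hg : IsQuadratic g') {φ : M → M'}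
    (hφ : ContMDiff I I' 1 φ) (hsec : HasLocalSections I I' φ)
    (hcomp : IsCompleteMetric (inducedMetric I g' φ))
    (hsep : ∀ (s : ℕ → M') (y z : M'), Tendsto s atTop (𝓝 y) →
      Tendsto (fun i => riemDist g' (s i) z) atTop (𝓝 0) → z = y)
    {p : M} {y : M'} {r : ℝ≥0∞} (h : riemDist g' (φ p) y < r) :
    ∃ q, φ q = y ∧ riemDist (inducedMetric I g' φ) p q < r := by
  obtain ⟨γ, h0, h1, hγ, hl⟩ := exists_path_of_riemDist_lt h
  obtain ⟨q, hq, hd⟩ := exists_lift_endpoint hg hφ hsec hcomp hsep hγ hl.ne_top h0.symm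
  exact ⟨q, hq.trans h1, hd.trans_lt hl⟩

/-- The target of a surjective local isometry with complete source is complete. -/
theorem isCompleteMetric_of_surjective {g' : MetricField I' M'} (hg : IsQuadratic g')
    {φ : M → M'} (hφ : ContMDiff I I' 1 φ) (hsec : HasLocalSections I I' φ)
    (hcomp : IsCompleteMetric (inducedMetric I g' φ))
    (hsep : ∀ (s : ℕ → M') (y z : M'), Tendsto s atTop (𝓝 y) →
      Tendsto (fun i => riemDist g' (s i) z) atTop (𝓝 0) → z = y)
    (hsurj : Function.Surjective φ) : IsCompleteMetric g' := by
  intro s hs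
  set g := inducedMetric I g' φ with hgdef
  have hgq : IsQuadratic g := inducedMetric_isQuadratic (I := I) hg φ
  -- A subsequence with steps below `2⁻ᵏ` is lifted point by point; the tails of the geometric
  -- series, `2 * 2⁻ⁱ`, make the lift Cauchy.
  let δ : ℕ → ℝ≥0∞ := fun k => 2⁻¹ ^ k
  have hδ : ∀ k, 0 < δ k := fun k => ENNReal.pow_pos (by simp) k
  choose N hN using fun k => hs (δ k) (hδ k)
  -- The partial sums dominate `N` and are monotone; the added `k` makes `u` unbounded, which the
  -- comparison with the full sequence needs at the end.
  let u : ℕ → ℕ := fun k => ∑ i ∈ Finset.range (k + 1), N i + k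
  have huN : ∀ k, N k ≤ u k := fun k =>
    (Finset.single_le_sum (f := N) (fun _ _ => Nat.zero_le _) (Finset.self_mem_range_succ k)).trans
      (Nat.le_add_right _ _)
  have humono : ∀ k, u k ≤ u (k + 1) := fun k => by
    simp only [u, Finset.sum_range_succ _ (k + 1)]
    lia
  have hstep : ∀ k, riemDist g' (s (u k)) (s (u (k + 1))) < δ k := fun k =>
    hN k _ _ (huN k) ((huN k).trans (humono k))
  have hlift : ∀ k (p : M), φ p = s (u k) → ∃ q, φ q = s (u (k + 1)) ∧ riemDist g p q < δ k := by
    intro k p hp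
    exact exists_lift_of_riemDist_lt hg hφ hsec hcomp hsep (by rw [hp]; exact hstep k)
  choose! F hF using hlift
  obtain ⟨p₀, hp₀⟩ := hsurj (s (u 0))
  let p : ℕ → M := fun k => Nat.rec p₀ (fun k q => F k q) k
  have hp : ∀ k, φ (p k) = s (u k) := by
    intro k
    induction k with
    | zero => exact hp₀
    | succ k ih => exact (hF k _ ih).1
  have hpd : ∀ k, riemDist g (p k) (p (k + 1)) ≤ δ k := fun k => (hF k _ (hp k)).2.le
  have hsum : ∀ i m, riemDist g (p i) (p (i + m)) ≤ ∑ k ∈ Finset.range m, δ (i + k) := by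
    intro i m
    induction m with
    | zero => simp [riemDist_self hgq]
    | succ m ih =>
      rw [Finset.sum_range_succ]
      exact (riemDist_triangle hgq _ (p (i + m)) _).trans (add_le_add ih (hpd (i + m)))
  have hbound : ∀ i m, riemDist g (p i) (p (i + m)) ≤ δ i * 2 := by
    intro i m
    refine (hsum i m).trans ?_
    simp only [δ, pow_add, ← Finset.mul_sum]
    gcongr
    refine (ENNReal.sum_le_tsum _).trans_eq ?_
    rw [ENNReal.tsum_geometric, ENNReal.one_sub_inv_two, inv_inv]
  have hδlim : Tendsto (fun i => δ i * 2) atTop (𝓝 0) := by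
    have : Tendsto δ atTop (𝓝 0) := ENNReal.tendsto_pow_atTop_nhds_zero_of_lt_one (by simp)
    simpa using ENNReal.Tendsto.mul_const this (b := 2) (Or.inr (by simp))
  obtain ⟨q, hq⟩ := hcomp p (by
    intro ε hε
    obtain ⟨K, hK⟩ := eventually_atTop.1 (hδlim.eventually (gt_mem_nhds hε))
    refine ⟨K, fun i j hi hj => ?_⟩
    rcases le_total i j with h | h
    · obtain ⟨m, rfl⟩ := Nat.exists_eq_add_of_le h
      exact (hbound i m).trans_lt (hK i hi)
    · obtain ⟨m, rfl⟩ := Nat.exists_eq_add_of_le h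
      rw [riemDist_comm hgq]
      exact (hbound j m).trans_lt (hK j hj))
  refine ⟨φ q, ?_⟩
  have hsub : Tendsto (fun k => riemDist g' (s (u k)) (φ q)) atTop (𝓝 0) := by
    refine tendsto_of_tendsto_of_tendsto_of_le_of_le tendsto_const_nhds hq
      (fun _ => zero_le) fun k => ?_
    have := riemDist_le_of_inducedMetric (I := I) hg hφ (p k) q
    rwa [hp k] at this
  rw [ENNReal.tendsto_nhds_zero]
  intro ε hε
  have hε2 : 0 < ε / 2 := ENNReal.half_pos hε.ne'
  obtain ⟨K, hK⟩ := hs (ε / 2) hε2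
  obtain ⟨k, hk, hkK⟩ := ((hsub.eventually (gt_mem_nhds hε2)).and (eventually_ge_atTop K)).exists
  have huk : K ≤ u k := hkK.trans (Nat.le_add_left _ _)
  filter_upwards [eventually_ge_atTop K] with i hi
  calc riemDist g' (s i) (φ q) ≤ riemDist g' (s i) (s (u k)) + riemDist g' (s (u k)) (φ q) :=
        riemDist_triangle hg _ _ _
    _ ≤ ε / 2 + ε / 2 := add_le_add (hK i _ hi huk).le hk.le
    _ = ε := ENNReal.add_halves ε

end Length

/-! ### The inverse function theorem in charts. -/

section LocalSections

variable {E : Type*} [NormedAddCommGroup E] [NormedSpace ℝ E] [FiniteDimensional ℝ E]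
  {H : Type*} [TopologicalSpace H] {H' : Type*} [TopologicalSpace H']
  {I : ModelWithCorners ℝ E H} {I' : ModelWithCorners ℝ E H'} [I.Boundaryless]
  {M : Type*} [TopologicalSpace M] [ChartedSpace H M] [IsManifold I 1 M]
  {M' : Type*} [TopologicalSpace M'] [ChartedSpace H' M'] [IsManifold I' 1 M']

/-- The inverse function theorem: an immersion between manifolds of the same dimension has local
sections. -/
theorem hasLocalSections_of_injective {φ : M → M'} (hφ : ContMDiff I I' 1 φ)
    (hinj : ∀ p, Function.Injective (mfderiv I I' φ p)) : HasLocalSections I I' φ := by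
  intro q
  set F : E → E := writtenInExtChartAt I I' q φ with hF
  have hFc : ContDiffAt ℝ 1 F (extChartAt I q q) := by
    have := ((contMDiffAt_iff.1 (hφ q)).2)
    rwa [I.range_eq_univ, contDiffWithinAt_univ] at this
  have hFq : F (extChartAt I q q) = extChartAt I' (φ q) (φ q) := by
    simp [hF, writtenInExtChartAt]
  have hD : HasFDerivAt F (fderiv ℝ F (extChartAt I q q)) (extChartAt I q q) :=
    (hFc.differentiableAt one_ne_zero).hasFDerivAt
  have hinjF : Function.Injective (fderiv ℝ F (extChartAt I q q)) := by
    have h := hinj q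
    rw [(hφ.mdifferentiableAt one_ne_zero).mfderiv, I.range_eq_univ, fderivWithin_univ] at h
    exact h
  let A : E ≃L[ℝ] E := (LinearEquiv.ofInjectiveEndo
    (fderiv ℝ F (extChartAt I q q) : E →ₗ[ℝ] E) hinjF).toContinuousLinearEquiv
  have hA : (A : E →L[ℝ] E) = fderiv ℝ F (extChartAt I q q) := by ext; rfl
  rw [← hA] at hD
  let G := hFc.localInverse hD one_ne_zero
  have hG : ContDiffAt ℝ 1 G (extChartAt I' (φ q) (φ q)) := by
    rw [← hFq]; exact hFc.to_localInverse hD one_ne_zero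
  have hGq : G (extChartAt I' (φ q) (φ q)) = extChartAt I q q := by
    rw [← hFq]; exact hFc.localInverse_apply_image hD one_ne_zero
  have hFG : ∀ᶠ z in 𝓝 (extChartAt I' (φ q) (φ q)), F (G z) = z := by
    rw [← hFq]
    exact (hFc.hasStrictFDerivAt' hD one_ne_zero).eventually_right_inverse
  let σ : M' → M := fun y => (extChartAt I q).symm (G (extChartAt I' (φ q) y))
  have hσq : σ (φ q) = q := by
    simp only [σ, hGq, extChartAt_to_inv]
  have hσ : ContMDiffAt I' I 1 σ (φ q) := by
    have h1 : ContMDiffAt I' 𝓘(ℝ, E) 1 (fun y => G (extChartAt I' (φ q) y)) (φ q) :=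
      (contMDiffAt_iff_contDiffAt.2 hG).comp (φ q) contMDiffAt_extChartAt
    refine ContMDiffAt.comp (φ q) ?_ h1
    rw [hGq]
    exact (contMDiffOn_extChartAt_symm q).contMDiffAt (extChartAt_target_mem_nhds q)
  have hσc : Tendsto σ (𝓝 (φ q)) (𝓝 q) := by
    have := hσ.continuousAt.tendsto
    rwa [hσq] at this
  have hev : ∀ᶠ y in 𝓝 (φ q), ContMDiffAt I' I 1 σ y ∧ φ (σ y) = y := by
    filter_upwards [(contMDiffAt_iff_contMDiffAt_nhds (by simp)).1 hσ,
       (continuousAt_extChartAt (I := I') (φ q)).eventually hFG,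
      extChartAt_source_mem_nhds (I := I') (φ q),
      hσc.eventually ((hφ.continuous.continuousAt (x := q)).eventually
        (extChartAt_source_mem_nhds (I := I') (φ q)))] with y h1 h2 h3 h4
    -- Both `φ (σ y)` and `y` lie in the chart domain, so `F (G z) = z` can be read back on the
    -- manifold.
    refine ⟨h1, (extChartAt I' (φ q)).injOn h4 h3 ?_⟩
    exact h2
  refine ⟨σ, _, hev, fun y hy => hy.1.contMDiffWithinAt, hσq, fun y hy => hy.2⟩

end LocalSections

/-! ### Riemannian distance: separation, finiteness, surjectivity. -/

section Riemannian

variable {E : Type*} [NormedAddCommGroup E] [NormedSpace ℝ E]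
  {H : Type*} [TopologicalSpace H] {I : ModelWithCorners ℝ E H}
  {M : Type*} [TopologicalSpace M] [ChartedSpace H M] [IsManifold I ∞ M]

/-- The field of inner products of a smooth Riemannian metric. -/
def riemMetric (gM : ContMDiffRiemannianMetric I ∞ E (TangentSpace I : M → Type _)) :
    MetricField I M :=
  fun x a b => gM.inner x a b

theorem riemMetric_isQuadratic
    (gM : ContMDiffRiemannianMetric I ∞ E (TangentSpace I : M → Type _)) :
    IsQuadratic (riemMetric gM) := by
  intro x c a
  simp only [riemMetric, map_smul, FunLike.coe_smul, Pi.smul_apply, smul_eq_mul]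
  ring

theorem riemMetric_bilin
    (gM : ContMDiffRiemannianMetric I ∞ E (TangentSpace I : M → Type _)) (x : M) :
    ∃ B : E →ₗ[ℝ] E →ₗ[ℝ] ℝ, ∀ a b : E, riemMetric gM x a b = B a b :=
  ⟨LinearMap.mk₂ ℝ (fun a b : E => gM.inner x a b)
      (fun a a' b => congrArg (fun L => L b) ((gM.inner x).map_add a a'))
      (fun r a b => congrArg (fun L => L b) ((gM.inner x).map_smul r a))
      (fun a b b' => (gM.inner x a).map_add b b')
      (fun r a b => (gM.inner x a).map_smul r b), fun _ _ => rfl⟩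

theorem riemDist_riemMetric (gM : ContMDiffRiemannianMetric I ∞ E (TangentSpace I : M → Type _))
    (x y : M) :
    letI : RiemannianBundle (fun x : M => TangentSpace I x) := ⟨gM.toRiemannianMetric⟩
    riemDist (riemMetric gM) x y = Manifold.riemannianEDist I x y := by
  let _ : RiemannianBundle (fun x : M => TangentSpace I x) := ⟨gM.toRiemannianMetric⟩
  unfold riemDist
  congr 1
  funext z
  congr 1
  funext a
  change _ = ‖a‖ₑ
  rw [← ofReal_norm, norm_eq_sqrt_real_inner]
  rfl

/-- Every neighbourhood of `z` contains a distance ball, so convergence in distance is convergence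
in the topology, where limits are unique. This supplies the hypothesis `hsep` of the lifting lemmas.
-/
theorem eq_of_tendsto_riemDist [T2Space M] [LocallyCompactSpace M]
    (gM : ContMDiffRiemannianMetric I ∞ E (TangentSpace I : M → Type _)) (s : ℕ → M) (y z : M)
    (hy : Tendsto s atTop (𝓝 y))
    (hz : Tendsto (fun i => riemDist (riemMetric gM) (s i) z) atTop (𝓝 0)) : z = y := by
  have : IsManifold I 1 M := .of_le (n := ∞) (by simp)
  let _ : RiemannianBundle (fun x : M => TangentSpace I x) := ⟨gM.toRiemannianMetric⟩
  have : IsContinuousRiemannianBundle E (fun x : M => TangentSpace I x) :=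
    ⟨gM.inner, gM.contMDiff.continuous, fun _ _ _ => rfl⟩
  refine tendsto_nhds_unique ?_ hy
  refine tendsto_iff_forall_eventually_mem.2 fun t ht => ?_
  obtain ⟨c, hc, hct⟩ := setOfPred_riemannianEDist_lt_subset_nhds' I ht
  filter_upwards [hz.eventually (gt_mem_nhds hc)] with i hi
  refine hct ?_
  rw [riemDist_comm (riemMetric_isQuadratic gM), riemDist_riemMetric] at hi
  exact hi

/-- Nearby points are at finite distance, so the points at finite distance from `x` form a clopen
set. -/
theorem riemDist_lt_top [ConnectedSpace M]
    (gM : ContMDiffRiemannianMetric I ∞ E (TangentSpace I : M → Type _)) (x y : M) :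
    riemDist (riemMetric gM) x y < ⊤ := by
  have : IsManifold I 1 M := .of_le (n := ∞) (by simp)
  have hq := riemMetric_isQuadratic gM
  have hev : ∀ z : M, ∀ᶠ w in 𝓝 z, riemDist (riemMetric gM) z w < ⊤ := by
    intro z
    simp only [riemDist_riemMetric]
    let _ : RiemannianBundle (fun x : M => TangentSpace I x) := ⟨gM.toRiemannianMetric⟩
    have : IsContinuousRiemannianBundle E (fun x : M => TangentSpace I x) :=
      ⟨gM.inner, gM.contMDiff.continuous, fun _ _ _ => rfl⟩
    exact eventually_riemannianEDist_lt I z ENNReal.zero_lt_top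
  have hopen : IsOpen {y | riemDist (riemMetric gM) x y < ⊤} := by
    refine isOpen_iff_mem_nhds.2 fun z hz => ?_
    filter_upwards [hev z] with w hw
    exact (riemDist_triangle hq x z w).trans_lt (ENNReal.add_lt_top.2 ⟨hz, hw⟩)
  have hclosed : IsClosed {y | riemDist (riemMetric gM) x y < ⊤} := by
    refine isOpen_compl_iff.1 (isOpen_iff_mem_nhds.2 fun z hz => ?_)
    filter_upwards [hev z] with w hw hw'
    refine hz ((riemDist_triangle hq x w z).trans_lt (ENNReal.add_lt_top.2 ⟨hw', ?_⟩))
    rwa [riemDist_comm hq]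
  have := IsClopen.eq_univ ⟨hclosed, hopen⟩ ⟨x, by simp [riemDist_self hq]⟩
  exact this.ge (mem_univ y)

variable {E' : Type*} [NormedAddCommGroup E'] [NormedSpace ℝ E']
  {H' : Type*} [TopologicalSpace H'] {I' : ModelWithCorners ℝ E' H'}
  {S : Type*} [TopologicalSpace S] [ChartedSpace H' S] [Nonempty S]

/-- A local isometry from a complete manifold onto an open part of a connected Riemannian manifold
is surjective. -/
theorem surjective_of_isCompleteMetric [T2Space M] [LocallyCompactSpace M] [ConnectedSpace M]
    (gM : ContMDiffRiemannianMetric I ∞ E (TangentSpace I : M → Type _)) {φ : S → M}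
    (hφ : ContMDiff I' I 1 φ) (hsec : HasLocalSections I' I φ)
    (hcomp : IsCompleteMetric (inducedMetric I' (riemMetric gM) φ)) : Function.Surjective φ := by
  intro y
  obtain ⟨p⟩ := ‹Nonempty S›
  obtain ⟨q, hq, -⟩ := exists_lift_of_riemDist_lt (riemMetric_isQuadratic gM) hφ hsec hcomp
    (eq_of_tendsto_riemDist gM) (riemDist_lt_top gM (φ p) y)
  exact ⟨q, hq⟩

end Riemannian

/-! ### Linear algebra of the metric trace. -/

section Trace

variable {E : Type*} [NormedAddCommGroup E] [NormedSpace ℝ E] [FiniteDimensional ℝ E]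

theorem isUnit_det_gram {B : E →ₗ[ℝ] E →ₗ[ℝ] ℝ} (hB : B.SeparatingLeft) :
    IsUnit (Matrix.of fun i j =>
      B (Module.finBasis ℝ E i) (Module.finBasis ℝ E j)).det := by
  have h := (LinearMap.separatingLeft_iff_det_ne_zero (Module.finBasis ℝ E)).1 hB
  rw [isUnit_iff_ne_zero]
  convert h using 2
  ext i j
  simp [LinearMap.toMatrix₂_apply]

/-- The inverse Gram matrix represents linear forms. -/
theorem apply_sum_invGram {B : E →ₗ[ℝ] E →ₗ[ℝ] ℝ} (hB : B.SeparatingLeft) (l : E →ₗ[ℝ] ℝ)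
    (c : E) :
    B c (∑ i, ∑ j, (invGram (fun a b => B a b) i j * l (Module.finBasis ℝ E j)) •
      Module.finBasis ℝ E i) = l c := by
  suffices h : B.flip (∑ i, ∑ j, (invGram (fun a b => B a b) i j * l (Module.finBasis ℝ E j)) •
      Module.finBasis ℝ E i) = l from LinearMap.congr_fun h c
  refine (Module.finBasis ℝ E).ext fun k => ?_
  set G := Matrix.of fun i j => B (Module.finBasis ℝ E i) (Module.finBasis ℝ E j) with hG
  have hGG : G * G⁻¹ = 1 := Matrix.mul_nonsing_inv G (isUnit_det_gram hB)
  have hinv : invGram (fun a b => B a b) = G⁻¹ := rfl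
  rw [LinearMap.flip_apply]
  simp only [map_sum, map_smul, smul_eq_mul, hinv]
  rw [Finset.sum_comm]
  calc ∑ j, ∑ i, G⁻¹ i j * l (Module.finBasis ℝ E j) *
        B (Module.finBasis ℝ E k) (Module.finBasis ℝ E i)
      = ∑ j, (G * G⁻¹) k j * l (Module.finBasis ℝ E j) := by
        refine Finset.sum_congr rfl fun j _ => ?_
        rw [Matrix.mul_apply, Finset.sum_mul]
        refine Finset.sum_congr rfl fun i _ => ?_
        simp only [hG, Matrix.of_apply]
        ring
    _ = l (Module.finBasis ℝ E k) := by
        simp [hGG, Matrix.one_apply]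

/-- The metric trace does not depend on the coordinates. -/
theorem metricTrace_comp {B S : E →ₗ[ℝ] E →ₗ[ℝ] ℝ} (hB : B.SeparatingLeft) (A : E ≃ₗ[ℝ] E) :
    metricTrace (fun a b => B (A a) (A b)) (fun a b => S (A a) (A b)) =
      metricTrace (fun a b => B a b) (fun a b => S a b) := by
  let e := Module.finBasis ℝ E
  -- The trace is `tr (G⁻¹ Tᵀ)`. Replacing `G`, `T` by `Pᵀ G P`, `Pᵀ T P` conjugates the matrix `G⁻¹
  -- Tᵀ` by `P`.
  have htr : ∀ B S : E →ₗ[ℝ] E →ₗ[ℝ] ℝ, metricTrace (fun a b => B a b) (fun a b => S a b) =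
      ((LinearMap.toMatrix₂ e e B)⁻¹ * (LinearMap.toMatrix₂ e e S).transpose).trace := by
    intro B S
    have : invGram (fun a b => B a b) = (LinearMap.toMatrix₂ e e B)⁻¹ := by
      unfold invGram
      congr 1
      ext i j
      simp [e, LinearMap.toMatrix₂_apply]
    simp [metricTrace, this, Matrix.trace, Matrix.mul_apply, LinearMap.toMatrix₂_apply, e]
  have hdet := (LinearMap.separatingLeft_iff_det_ne_zero e).1 hB
  have h1 := htr (B.compl₁₂ (A : E →ₗ[ℝ] E) (A : E →ₗ[ℝ] E))
    (S.compl₁₂ (A : E →ₗ[ℝ] E) (A : E →ₗ[ℝ] E))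
  simp only [LinearMap.compl₁₂_apply, LinearEquiv.coe_coe] at h1
  rw [h1, htr, LinearMap.toMatrix₂_compl₁₂ e e, LinearMap.toMatrix₂_compl₁₂ e e]
  set P := LinearMap.toMatrix e e (A : E →ₗ[ℝ] E)
  have hP : IsUnit P.det := A.isUnit_det e e
  have hPT : IsUnit P.transpose.det := by rwa [Matrix.det_transpose]
  set G := LinearMap.toMatrix₂ e e B
  set T := LinearMap.toMatrix₂ e e S
  rw [Matrix.mul_inv_rev, Matrix.mul_inv_rev, Matrix.transpose_mul, Matrix.transpose_mul,
    Matrix.transpose_transpose]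
  calc (P⁻¹ * (G⁻¹ * P.transpose⁻¹) * (P.transpose * (T.transpose * P))).trace
      = (P⁻¹ * (G⁻¹ * (P.transpose⁻¹ * P.transpose) * T.transpose) * P).trace := by
        simp only [Matrix.mul_assoc]
    _ = (G⁻¹ * T.transpose).trace := by
        rw [Matrix.nonsing_inv_mul _ hPT, Matrix.mul_one, Matrix.trace_mul_comm, ← Matrix.mul_assoc,
          Matrix.mul_nonsing_inv _ hP, Matrix.one_mul]

end Trace

/-! ### Metrics and maps read in charts. -/

section Charts

variable {E : Type*} [NormedAddCommGroup E] [NormedSpace ℝ E]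
  {H : Type*} [TopologicalSpace H]
  {E' : Type*} [NormedAddCommGroup E'] [NormedSpace ℝ E']
  {H' : Type*} [TopologicalSpace H']
  {E'' : Type*} [NormedAddCommGroup E''] [NormedSpace ℝ E'']
  {H'' : Type*} [TopologicalSpace H'']
  {I : ModelWithCorners ℝ E H} {I' : ModelWithCorners ℝ E' H'} {I'' : ModelWithCorners ℝ E'' H''}
  {M : Type*} [TopologicalSpace M] [ChartedSpace H M]
  {M' : Type*} [TopologicalSpace M'] [ChartedSpace H' M']
  {M'' : Type*} [TopologicalSpace M''] [ChartedSpace H'' M'']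

/-- All tangent spaces are the model space `E`, so vectors stay fixed while the base point is
rewritten along an equality that is not definitional. -/
theorem metricField_congr (g : MetricField I M) {x y : M} (h : x = y) (a b : E) :
    g x a b = g y a b := by
  subst h; rfl

theorem inducedMetric_congr (g : MetricField I' M') {f₁ f₂ : M → M'} {x : M}
    (h : f₁ =ᶠ[𝓝 x] f₂) (a b : TangentSpace I x) :
    inducedMetric I g f₁ x a b = inducedMetric I g f₂ x a b := by
  unfold inducedMetric
  rw [h.mfderiv_eq]
  exact metricField_congr g h.eq_of_nhds _ _

theorem inducedMetric_comp (g : MetricField I'' M'') {f : M' → M''} {h : M → M'} {x : M}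
    (hf : MDifferentiableAt I' I'' f (h x)) (hh : MDifferentiableAt I I' h x)
    (a b : TangentSpace I x) :
    inducedMetric I g (f ∘ h) x a b =
      inducedMetric I' g f (h x) (mfderiv I I' h x a) (mfderiv I I' h x b) := by
  unfold inducedMetric
  rw [mfderiv_comp x hf hh]
  rfl

theorem writtenInExtChartAt_self (φ : M → M') (p : M) :
    writtenInExtChartAt I I' p φ (extChartAt I p p) = extChartAt I' (φ p) (φ p) := by
  simp [writtenInExtChartAt]

theorem eventually_mem_extChartAt_source {φ : M → M'} {p : M} (hφ : ContinuousAt φ p) :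
    ∀ᶠ y in 𝓝 (extChartAt I p p),
      φ ((extChartAt I p).symm y) ∈ (extChartAt I' (φ p)).source := by
  have h1 : Tendsto (extChartAt I p).symm (𝓝 (extChartAt I p p)) (𝓝 p) := by
    have := (continuousAt_extChartAt_symm (I := I) p).tendsto
    rwa [extChartAt_to_inv] at this
  exact h1.eventually (hφ.eventually (extChartAt_source_mem_nhds (I := I') (φ p)))

variable [I.Boundaryless]

/-- The tangent space at `p` is identified with `E` through the preferred chart, so the inverse
chart has identity derivative at its centre. -/
theorem metricInChart_self [IsManifold I 1 M] (g : MetricField I M) (p : M) (a b : E) :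
    metricInChart g p (extChartAt I p p) a b = g p a b := by
  have h := mfderivWithin_range_extChartAt_symm (I := I) (x := p)
  rw [I.range_eq_univ, mfderivWithin_univ] at h
  unfold metricInChart
  rw [h]
  exact metricField_congr g (extChartAt_to_inv p) _ _

theorem mfderiv_eq_fderiv_writtenInExtChartAt {φ : M → M'} {p : M}
    (hφ : MDifferentiableAt I I' φ p) :
    (mfderiv I I' φ p : E →L[ℝ] E') =
      fderiv ℝ (writtenInExtChartAt I I' p φ) (extChartAt I p p) := by
  rw [hφ.mfderiv, I.range_eq_univ, fderivWithin_univ]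

theorem contDiffAt_writtenInExtChartAt {n : ℕ∞ω} {φ : M → M'} {p : M}
    (hφ : ContMDiffAt I I' n φ p) :
    ContDiffAt ℝ n (writtenInExtChartAt I I' p φ) (extChartAt I p p) := by
  have := (contMDiffAt_iff.1 hφ).2
  rwa [I.range_eq_univ, contDiffWithinAt_univ] at this

theorem mdifferentiableAt_extChartAt_symm_of_mem [IsManifold I 1 M] {p : M} {y : E}
    (hy : y ∈ (extChartAt I p).target) :
    MDifferentiableAt 𝓘(ℝ, E) I (extChartAt I p).symm y := by
  have := mdifferentiableWithinAt_extChartAt_symm (I := I) hy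
  rwa [I.range_eq_univ, mdifferentiableWithinAt_univ] at this

/-- The components of an induced metric in a chart. -/
theorem eventually_metricInChart_inducedMetric [I'.Boundaryless] [IsManifold I 1 M] [IsManifold I' 1 M']
    (g : MetricField I' M') {φ : M → M'} (hφ : ContMDiff I I' 1 φ) (p : M) :
    ∀ᶠ y in 𝓝 (extChartAt I p p), ∀ a b, metricInChart (inducedMetric I g φ) p y a b =
      metricInChart g (φ p) (writtenInExtChartAt I I' p φ y)
        (fderiv ℝ (writtenInExtChartAt I I' p φ) y a)
        (fderiv ℝ (writtenInExtChartAt I I' p φ) y b) := by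
  set F := writtenInExtChartAt I I' p φ with hF
  have hFc : ContDiffAt ℝ 1 F (extChartAt I p p) := contDiffAt_writtenInExtChartAt (hφ p)
  filter_upwards [hFc.eventually (by simp), extChartAt_target_mem_nhds (I := I) p,
    eventually_mem_extChartAt_source (I := I) (I' := I') (hφ.continuous.continuousAt (x := p)),
    (eventually_mem_extChartAt_source (I := I) (I' := I')
      (hφ.continuous.continuousAt (x := p))).eventually_nhds] with y h1 h2 h3 h4 a b
  have hFy : MDifferentiableAt 𝓘(ℝ, E) 𝓘(ℝ, E') F y :=
    (h1.differentiableAt one_ne_zero).mdifferentiableAt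
  have hFt : F y ∈ (extChartAt I' (φ p)).target := (extChartAt I' (φ p)).map_source h3
  -- The two factorisations agree on a neighbourhood of `y`, not only at `y`, so they have the same
  -- derivative there.
  have heq : φ ∘ (extChartAt I p).symm =ᶠ[𝓝 y] (extChartAt I' (φ p)).symm ∘ F := by
    filter_upwards [h4] with z hz
    exact ((extChartAt I' (φ p)).left_inv hz).symm
  calc metricInChart (inducedMetric I g φ) p y a b
      = inducedMetric 𝓘(ℝ, E) g (φ ∘ (extChartAt I p).symm) y a b :=
        (inducedMetric_comp g (hφ.mdifferentiableAt one_ne_zero)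
          (mdifferentiableAt_extChartAt_symm_of_mem h2) a b).symm
    _ = inducedMetric 𝓘(ℝ, E) g ((extChartAt I' (φ p)).symm ∘ F) y a b :=
        inducedMetric_congr g heq a b
    _ = _ := by
        refine (inducedMetric_comp g (mdifferentiableAt_extChartAt_symm_of_mem hFt) hFy a b).trans ?_
        rw [mfderiv_eq_fderiv]
        rfl

end Charts

/-! ### Christoffel symbols and the Laplacian under local isometries. -/

section Christoffel

set_option synthInstance.maxHeartbeats 200000

variable {E : Type*} [NormedAddCommGroup E] [NormedSpace ℝ E] [FiniteDimensional ℝ E]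
  {H : Type*} [TopologicalSpace H] {H' : Type*} [TopologicalSpace H']
  {I : ModelWithCorners ℝ E H} {I' : ModelWithCorners ℝ E H'}
  {M : Type*} [TopologicalSpace M] [ChartedSpace H M]
  {S : Type*} [TopologicalSpace S] [ChartedSpace H' S]

/-- `G` gives the components, near `p`, of the metric `g` in the preferred chart at `p`, is
differentiable at `p` and is a nondegenerate symmetric form at `p`. -/
structure IsChartMetric (g : MetricField I M) (p : M) (G : E → E →L[ℝ] E →L[ℝ] ℝ) : Prop where
  eventually_eq : ∀ᶠ y in 𝓝 (extChartAt I p p), ∀ a b, metricInChart g p y a b = G y a b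
  differentiableAt : DifferentiableAt ℝ G (extChartAt I p p)
  symm : ∀ a b, G (extChartAt I p p) a b = G (extChartAt I p p) b a
  nondegenerate : ∀ a, (∀ b, G (extChartAt I p p) a b = 0) → a = 0

namespace IsChartMetric

variable {g : MetricField I M} {p : M} {G : E → E →L[ℝ] E →L[ℝ] ℝ}

theorem fderiv_metricInChart (h : IsChartMetric g p G) (a b c : E) :
    fderiv ℝ (fun y => metricInChart g p y b c) (extChartAt I p p) a =
      fderiv ℝ G (extChartAt I p p) a b c := by
  have heq : (fun y => metricInChart g p y b c) =ᶠ[𝓝 (extChartAt I p p)] fun y => G y b c :=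
    h.eventually_eq.mono fun y hy => hy b c
  rw [heq.fderiv_eq]
  have := (h.differentiableAt.hasFDerivAt.clm_apply
    (hasFDerivAt_const b (extChartAt I p p))).clm_apply (hasFDerivAt_const c (extChartAt I p p))
  rw [this.fderiv]
  simp

theorem christoffelFirst_eq (h : IsChartMetric g p G) (a b c : E) :
    christoffelFirst g p a b c = (fderiv ℝ G (extChartAt I p p) a b c
      + fderiv ℝ G (extChartAt I p p) b a c - fderiv ℝ G (extChartAt I p p) c a b) / 2 := by
  unfold christoffelFirst
  rw [h.fderiv_metricInChart, h.fderiv_metricInChart, h.fderiv_metricInChart]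

theorem separatingLeft (h : IsChartMetric g p G) :
    (G (extChartAt I p p)).toLinearMap₁₂.SeparatingLeft :=
  fun a ha => h.nondegenerate a ha

/-- The Christoffel symbol of the second kind represents that of the first kind. -/
theorem apply_christoffel (h : IsChartMetric g p G) (a b c : E) :
    G (extChartAt I p p) c (christoffel g p a b) = christoffelFirst g p a b c := by
  let l : E →ₗ[ℝ] ℝ :=
    { toFun := fun c => christoffelFirst g p a b c
      map_add' := fun c c' => by
        simp only [h.christoffelFirst_eq, map_add, add_apply]
        ring
      map_smul' := fun r c => by
        simp only [h.christoffelFirst_eq, map_smul, smul_apply, smul_eq_mul,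
          RingHom.id_apply]
        ring }
  have hB : metricInChart g p (extChartAt I p p) =
      fun a b => (G (extChartAt I p p)).toLinearMap₁₂ a b := by
    funext a b
    exact h.eventually_eq.self_of_nhds a b
  have := apply_sum_invGram h.separatingLeft l c
  unfold christoffel
  rw [hB]
  exact this

/-- Nondegeneracy reduces identities between Christoffel symbols of the second kind to the explicit
ones of the first kind. -/
theorem eq_of_apply_eq (h : IsChartMetric g p G) {v w : E}
    (hvw : ∀ c, G (extChartAt I p p) c v = G (extChartAt I p p) c w) : v = w := by
  refine sub_eq_zero.1 (h.nondegenerate _ fun c => ?_)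
  rw [h.symm, map_sub, hvw, sub_self]

theorem christoffel_add_left (h : IsChartMetric g p G) (a a' b : E) :
    christoffel g p (a + a') b = christoffel g p a b + christoffel g p a' b := by
  refine h.eq_of_apply_eq fun c => ?_
  simp only [map_add, h.apply_christoffel, h.christoffelFirst_eq, add_apply]
  ring

theorem christoffel_add_right (h : IsChartMetric g p G) (a b b' : E) :
    christoffel g p a (b + b') = christoffel g p a b + christoffel g p a b' := by
  refine h.eq_of_apply_eq fun c => ?_
  simp only [map_add, h.apply_christoffel, h.christoffelFirst_eq, add_apply]
  ring

theorem christoffel_smul_left (h : IsChartMetric g p G) (r : ℝ) (a b : E) :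
    christoffel g p (r • a) b = r • christoffel g p a b := by
  refine h.eq_of_apply_eq fun c => ?_
  simp only [map_smul, h.apply_christoffel, h.christoffelFirst_eq, smul_apply,
    smul_eq_mul]
  ring

theorem christoffel_smul_right (h : IsChartMetric g p G) (r : ℝ) (a b : E) :
    christoffel g p a (r • b) = r • christoffel g p a b := by
  refine h.eq_of_apply_eq fun c => ?_
  simp only [map_smul, h.apply_christoffel, h.christoffelFirst_eq, smul_apply,
    smul_eq_mul]
  ring

end IsChartMetric

variable [I.Boundaryless] [I'.Boundaryless]

/-- For `C²` maps the definition becomes an iterated Fréchet derivative, to which symmetry and the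
chain rule apply. -/
theorem secondDerivInChart_eq {E₂ : Type*} [NormedAddCommGroup E₂] [NormedSpace ℝ E₂]
    [FiniteDimensional ℝ E₂]
    {H₂ : Type*} [TopologicalSpace H₂] {I₂ : ModelWithCorners ℝ E₂ H₂}
    {M₂ : Type*} [TopologicalSpace M₂] [ChartedSpace H₂ M₂] {f : M → M₂} {p : M}
    (hf : ContMDiffAt I I₂ 2 f p) (a b : E) :
    secondDerivInChart I I₂ f p a b =
      fderiv ℝ (fderiv ℝ (writtenInExtChartAt I I₂ p f)) (extChartAt I p p) a b := by
  have hd : DifferentiableAt ℝ (fderiv ℝ (writtenInExtChartAt I I₂ p f)) (extChartAt I p p) :=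
    ((contDiffAt_writtenInExtChartAt hf).fderiv_right (m := 1) (by norm_num)).differentiableAt
      one_ne_zero
  unfold secondDerivInChart
  rw [(hd.hasFDerivAt.clm_apply (hasFDerivAt_const b _)).fderiv]
  simp

/-- The transformation law of the Christoffel symbols. -/
theorem IsChartMetric.fderiv_christoffel_inducedMetric [IsManifold I 1 M] [IsManifold I' 1 S]
    {g : MetricField I M} {φ : S → M} {p : S} {G : E → E →L[ℝ] E →L[ℝ] ℝ}
    (h : IsChartMetric g (φ p) G) (hφ : ContMDiff I' I 2 φ)
    (hinj : Function.Injective (mfderiv I' I φ p)) (a b : E) :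
    mfderiv I' I φ p (christoffel (E := E) (inducedMetric I' g φ) p a b) =
      christoffel (E := E) g (φ p) (mfderiv I' I φ p a) (mfderiv I' I φ p b)
        + secondDerivInChart I' I φ p a b := by
  have hφ1 : ContMDiff I' I 1 φ := hφ.of_le (by norm_num)
  rw [secondDerivInChart_eq (hφ p)]
  have hm := mfderiv_eq_fderiv_writtenInExtChartAt (hφ1.mdifferentiableAt (x := p) one_ne_zero)
  set F := writtenInExtChartAt I' I p φ with hF
  set y := extChartAt I' p p with hy
  have hFy : F y = extChartAt I (φ p) (φ p) := writtenInExtChartAt_self φ p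
  have hFc : ContDiffAt ℝ 2 F y := contDiffAt_writtenInExtChartAt (hφ p)
  have hFd : HasFDerivAt F (fderiv ℝ F y) y := (hFc.differentiableAt (by norm_num)).hasFDerivAt
  have hFdd : HasFDerivAt (fderiv ℝ F) (fderiv ℝ (fderiv ℝ F) y) y :=
    ((hFc.fderiv_right (m := 1) (by norm_num)).differentiableAt one_ne_zero).hasFDerivAt
  have hsymmF : ∀ u v, fderiv ℝ (fderiv ℝ F) y u v = fderiv ℝ (fderiv ℝ F) y v u := fun u v =>
    (hFc.isSymmSndFDerivAt (by simp)) u v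
  set A := fderiv ℝ F y with hA
  set F2 := fderiv ℝ (fderiv ℝ F) y with hF2
  set z := extChartAt I (φ p) (φ p) with hz
  have hGd : HasFDerivAt G (fderiv ℝ G z) (F y) := by
    rw [hFy]; exact h.differentiableAt.hasFDerivAt
  have hcomp : ∀ᶠ w in 𝓝 y, ∀ u v, metricInChart (inducedMetric I' g φ) p w u v =
      G (F w) (fderiv ℝ F w u) (fderiv ℝ F w v) := by
    have hev := hFc.continuousAt.eventually (by rw [hFy]; exact h.eventually_eq)
    filter_upwards [eventually_metricInChart_inducedMetric g hφ1 p, hev] with w h1 h2 u v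
    rw [h1, h2]
  have hGF : HasFDerivAt (fun x => G (F x)) ((fderiv ℝ G z).comp A) y :=
    HasFDerivAt.comp (g := G) (g' := fderiv ℝ G z) y hGd hFd
  have hFv : ∀ v, HasFDerivAt (fun x => fderiv ℝ F x v) (F2.flip v) y := fun v => by
    simpa using hFdd.clm_apply (hasFDerivAt_const v y)
  have hderiv : ∀ u v w, fderiv ℝ (fun x => metricInChart (inducedMetric I' g φ) p x v w) y u =
      fderiv ℝ G z (A u) (A v) (A w) + G z (F2 u v) (A w) + G z (A v) (F2 u w) := by
    intro u v w
    have heq : (fun x => metricInChart (inducedMetric I' g φ) p x v w) =ᶠ[𝓝 y]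
        fun x => G (F x) (fderiv ℝ F x v) (fderiv ℝ F x w) := hcomp.mono fun x hx => hx v w
    rw [heq.fderiv_eq]
    have h1 := (hGF.clm_apply (hFv v)).clm_apply (hFv w)
    rw [show fderiv ℝ (fun x => G (F x) (fderiv ℝ F x v) (fderiv ℝ F x w)) y = _ from h1.fderiv]
    simp [hFy]
    ring
  -- Of the six terms containing `F2`, four cancel by symmetry of `F2` and `G`; the other two are
  -- equal and absorb the factor one half.
  have hfirst : ∀ c, christoffelFirst (inducedMetric I' g φ) p a b c =
      christoffelFirst g (φ p) (A a) (A b) (A c) + G z (A c) (F2 a b) := by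
    intro c
    rw [h.christoffelFirst_eq]
    unfold christoffelFirst
    rw [← hy, hderiv, hderiv, hderiv, hsymmF b a, hsymmF c a, hsymmF c b,
      h.symm (F2 a b), h.symm (F2 a c)]
    ring
  have hsurj : Function.Surjective A :=
    LinearMap.injective_iff_surjective (f := (A : E →ₗ[ℝ] E)) |>.1 (by rw [hm] at hinj; exact hinj)
  have hinjA : Function.Injective A := by rw [hm] at hinj; exact hinj
  let B : E →ₗ[ℝ] E →ₗ[ℝ] ℝ := (G z).toLinearMap₁₂.compl₁₂ (A : E →ₗ[ℝ] E) (A : E →ₗ[ℝ] E)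
  have hBapp : ∀ u v, B u v = G z (A u) (A v) := fun _ _ => rfl
  have hB : B.SeparatingLeft := by
    intro u hu
    refine hinjA ?_
    rw [map_zero]
    refine h.nondegenerate _ fun v => ?_
    obtain ⟨v, rfl⟩ := hsurj v
    exact hu v
  have hBchart : metricInChart (inducedMetric I' g φ) p y = fun u v => B u v := by
    funext u v
    rw [hcomp.self_of_nhds u v, hBapp, hFy]
  -- The pulled-back Christoffel vector represents `l` for the form `B`. Since `A` is onto, testing
  -- against the vectors `A c` determines its image under `A`.
  let l : E →ₗ[ℝ] ℝ := (G z).flip (christoffel g (φ p) (A a) (A b) + F2 a b) ∘L A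
  have hl : ∀ c, christoffelFirst (inducedMetric I' g φ) p a b c = l c := by
    intro c
    rw [hfirst, ← h.apply_christoffel, ← map_add]
    rfl
  rw [hm]
  refine h.eq_of_apply_eq fun c => ?_
  obtain ⟨c, rfl⟩ := hsurj c
  have key := apply_sum_invGram hB l c
  have hchr : christoffel (inducedMetric I' g φ) p a b = ∑ i, ∑ j,
      (invGram (fun u v => B u v) i j * l (Module.finBasis ℝ E j)) • Module.finBasis ℝ E i := by
    unfold christoffel
    rw [← hy, hBchart]
    simp only [hl]
  rw [← hchr] at key
  exact key

/-- The Laplacian is invariant under local isometries. -/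
theorem IsChartMetric.laplacian_inducedMetric [IsManifold I 1 M] [IsManifold I' 1 S]
    {g : MetricField I M} {φ : S → M} {p : S} {G : E → E →L[ℝ] E →L[ℝ] ℝ}
    (h : IsChartMetric g (φ p) G) (hφ : ContMDiff I' I 2 φ)
    (hinj : Function.Injective (mfderiv I' I φ p)) {f : M → ℝ}
    (hf : ContMDiff I 𝓘(ℝ, ℝ) 2 f) :
    laplacian (inducedMetric I' g φ) (f ∘ φ) p = laplacian g f (φ p) := by
  have hφ1 : ContMDiff I' I 1 φ := hφ.of_le (by norm_num)
  have hf1 : ContMDiff I 𝓘(ℝ, ℝ) 1 f := hf.of_le (by norm_num)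
  have hmφ := mfderiv_eq_fderiv_writtenInExtChartAt (hφ1.mdifferentiableAt (x := p) one_ne_zero)
  have hmf := mfderiv_eq_fderiv_writtenInExtChartAt (hf1.mdifferentiableAt (x := φ p) one_ne_zero)
  have hFc := contDiffAt_writtenInExtChartAt (hφ p)
  have hfc := contDiffAt_writtenInExtChartAt (hf (φ p))
  have htr := h.fderiv_christoffel_inducedMetric hφ hinj
  have hFy := writtenInExtChartAt_self (I := I') (I' := I) φ p
  have hwritten : writtenInExtChartAt I' 𝓘(ℝ, ℝ) p (f ∘ φ) =ᶠ[𝓝 (extChartAt I' p p)]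
      writtenInExtChartAt I 𝓘(ℝ, ℝ) (φ p) f ∘ writtenInExtChartAt I' I p φ := by
    filter_upwards [eventually_mem_extChartAt_source (I := I') (I' := I)
      (hφ.continuous.continuousAt (x := p))] with y hy
    have := (extChartAt I (φ p)).left_inv hy
    simp only [writtenInExtChartAt, Function.comp_apply, this]
  have hsecond := secondDerivInChart_eq ((hf.comp hφ) p)
  have hsecondφ := secondDerivInChart_eq (hφ p)
  have hsecondf := secondDerivInChart_eq (hf (φ p))
  set F := writtenInExtChartAt I' I p φ with hF
  set y := extChartAt I' p p with hy
  set f' := writtenInExtChartAt I 𝓘(ℝ, ℝ) (φ p) f with hf'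
  set z := extChartAt I (φ p) (φ p) with hz
  rw [← hFy] at hfc
  have hFd : HasFDerivAt F (fderiv ℝ F y) y := (hFc.differentiableAt (by norm_num)).hasFDerivAt
  have hFdd : HasFDerivAt (fderiv ℝ F) (fderiv ℝ (fderiv ℝ F) y) y :=
    ((hFc.fderiv_right (m := 1) (by norm_num)).differentiableAt one_ne_zero).hasFDerivAt
  have hfdd : HasFDerivAt (fderiv ℝ f') (fderiv ℝ (fderiv ℝ f') z) (F y) := by
    rw [← hFy]
    exact ((hfc.fderiv_right (m := 1) (by norm_num)).differentiableAt one_ne_zero).hasFDerivAt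
  have hD1 : fderiv ℝ (writtenInExtChartAt I' 𝓘(ℝ, ℝ) p (f ∘ φ)) =ᶠ[𝓝 y]
      fun w => (fderiv ℝ f' (F w)).comp (fderiv ℝ F w) := by
    filter_upwards [hwritten.eventuallyEq_nhds, hFc.eventually (by simp),
      hFc.continuousAt.eventually (hfc.eventually (by simp))] with w h1 h2 h3
    rw [h1.fderiv_eq]
    exact fderiv_comp w (h3.differentiableAt (by norm_num)) (h2.differentiableAt (by norm_num))
  have hD2 : ∀ a b, fderiv ℝ (fderiv ℝ (writtenInExtChartAt I' 𝓘(ℝ, ℝ) p (f ∘ φ))) y a b =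
      fderiv ℝ (fderiv ℝ f') z (fderiv ℝ F y a) (fderiv ℝ F y b)
        + fderiv ℝ f' z (fderiv ℝ (fderiv ℝ F) y a b) := by
    intro a b
    have h1 := (hfdd.comp y hFd).clm_comp hFdd
    rw [hD1.fderiv_eq, show fderiv ℝ (fun w => (fderiv ℝ f' (F w)).comp (fderiv ℝ F w)) y = _ from
      h1.fderiv]
    simp [hFy, add_comm]
  set A := fderiv ℝ F y with hA
  have hinjA : Function.Injective A := by rw [hmφ] at hinj; exact hinj
  have hmcomp : (mfderiv I' 𝓘(ℝ, ℝ) (f ∘ φ) p : E →L[ℝ] ℝ) = (fderiv ℝ f' z).comp A := by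
    rw [mfderiv_comp p (hf1.mdifferentiableAt one_ne_zero) (hφ1.mdifferentiableAt one_ne_zero)]
    exact congrArg₂ _ hmf hmφ
  have hessf : ∀ a b : E, hessian g f (φ p) a b =
      fderiv ℝ (fderiv ℝ f') z a b - fderiv ℝ f' z (christoffel g (φ p) a b) := by
    intro a b
    rw [← hsecondf, ← hmf]
    rfl
  -- The second derivative of `φ` enters once through the chain rule and once through the
  -- transformation law of the Christoffel symbols, with opposite signs.
  have hhess : ∀ a b : E, hessian (inducedMetric I' g φ) (f ∘ φ) p a b =
      hessian g f (φ p) (A a) (A b) := by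
    intro a b
    have h1 := htr a b
    rw [hmφ, hsecondφ] at h1
    have h2 : hessian (inducedMetric I' g φ) (f ∘ φ) p a b =
        fderiv ℝ (fderiv ℝ (writtenInExtChartAt I' 𝓘(ℝ, ℝ) p (f ∘ φ))) y a b
          - fderiv ℝ f' z (A (christoffel (inducedMetric I' g φ) p a b)) := by
      rw [← hsecond]
      exact congrArg (fun L : E →L[ℝ] ℝ => secondDerivInChart I' 𝓘(ℝ, ℝ) (f ∘ φ) p a b -
        L (christoffel (inducedMetric I' g φ) p a b)) hmcomp
    have h3 : A (christoffel (inducedMetric I' g φ) p a b) =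
      christoffel g (φ p) (A a) (A b) + fderiv ℝ (fderiv ℝ F) y a b := h1
    rw [h2, hessf, h3, hD2, map_add]
    ring
  let Q : E →ₗ[ℝ] E →ₗ[ℝ] ℝ := LinearMap.mk₂ ℝ (fun a b : E => hessian g f (φ p) a b)
    (fun a a' b => by
      rw [hessf, hessf, hessf, h.christoffel_add_left, map_add, map_add, add_apply]
      ring)
    (fun r a b => by
      rw [hessf, hessf, h.christoffel_smul_left, map_smul, map_smul, smul_apply, ← smul_sub])
    (fun a b b' => by
      rw [hessf, hessf, hessf, h.christoffel_add_right, map_add, map_add]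
      ring)
    (fun r a b => by
      rw [hessf, hessf, h.christoffel_smul_right, map_smul, map_smul, ← smul_sub])
  have hBz : ∀ a b : E, g (φ p) a b = (G z).toLinearMap₁₂ a b := fun a b => by
    rw [← metricInChart_self g (φ p) a b, h.eventually_eq.self_of_nhds a b]
    rfl
  let A' : E ≃ₗ[ℝ] E := LinearEquiv.ofInjectiveEndo (A : E →ₗ[ℝ] E) hinjA
  have key := metricTrace_comp (S := Q) h.separatingLeft A'
  unfold laplacian
  convert key using 1
  · congr 1
    · funext a b
      unfold inducedMetric
      rw [hmφ]
      exact hBz _ _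
    · funext a b
      exact hhess a b
  · congr 1
    funext a b
    exact hBz a b

end Christoffel

/-! ### Metrics with differentiable components. -/

theorem differentiableAt_sum_smul {E F ι : Type*} [NormedAddCommGroup E] [NormedSpace ℝ E]
    [NormedAddCommGroup F] [NormedSpace ℝ F] [Fintype ι] {c : ι → ι → E → ℝ} {x : E}
    (hc : ∀ i j, DifferentiableAt ℝ (c i j) x) (T : ι → ι → F) :
    DifferentiableAt ℝ (fun y => ∑ i, ∑ j, c i j y • T i j) x :=
  DifferentiableAt.fun_sum fun i _ => DifferentiableAt.fun_sum fun j _ => (hc i j).smul_const _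

section Components

set_option synthInstance.maxHeartbeats 200000

variable {E : Type*} [NormedAddCommGroup E] [NormedSpace ℝ E] [FiniteDimensional ℝ E]
  {H : Type*} [TopologicalSpace H] {I : ModelWithCorners ℝ E H} [I.Boundaryless]
  {M : Type*} [TopologicalSpace M] [ChartedSpace H M]

/-- A metric with differentiable components in the chart at `p`. -/
theorem exists_isChartMetric [IsManifold I 1 M] {g : MetricField I M} {p : M}
    (hbil : ∀ x, ∃ B : E →ₗ[ℝ] E →ₗ[ℝ] ℝ, ∀ a b : E, g x a b = B a b)
    (hsymm : ∀ a b : E, g p a b = g p b a)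
    (hnd : ∀ a : E, (∀ b : E, g p a b = 0) → a = 0)
    (hd : ∀ a b : E, DifferentiableAt ℝ (fun y => metricInChart g p y a b) (extChartAt I p p)) :
    ∃ G, IsChartMetric g p G := by
  let e := Module.finBasis ℝ E
  let l : Fin (Module.finrank ℝ E) → E →L[ℝ] ℝ := fun i => (e.coord i).toContinuousLinearMap
  let G : E → E →L[ℝ] E →L[ℝ] ℝ := fun y =>
    ∑ i, ∑ j, metricInChart g p y (e i) (e j) • (l i).smulRight (l j)
  -- Only bilinearity of `g` and linearity of the derivative are used, so this holds for every `y`,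
  -- even outside the chart.
  have hG : ∀ y a b, metricInChart g p y a b = G y a b := by
    intro y a b
    obtain ⟨B, hB⟩ := hbil ((extChartAt I p).symm y)
    let L' : E →L[ℝ] E := mfderiv 𝓘(ℝ, E) I (extChartAt I p).symm y
    let L : E →ₗ[ℝ] E := L'
    have hB' : ∀ a b, metricInChart g p y a b = B.compl₁₂ L L a b := fun a b => hB _ _
    simp only [G, hB', sum_apply, smul_apply,
      ContinuousLinearMap.smulRight_apply, smul_eq_mul, l, LinearMap.coe_toContinuousLinearMap',
      Module.Basis.coord_apply]
    rw [← LinearMap.sum_repr_mul_repr_mul e e]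
    rw [Finsupp.sum_fintype _ _ (by simp)]
    refine Finset.sum_congr rfl fun i _ => ?_
    rw [Finsupp.sum_fintype _ _ (by simp)]
    refine Finset.sum_congr rfl fun j _ => ?_
    simp only [smul_eq_mul]
    ring
  have hGp : ∀ a b : E, G (extChartAt I p p) a b = g p a b := fun a b => by
    rw [← hG, metricInChart_self]
  refine ⟨G, Eventually.of_forall hG, ?_, fun a b => ?_, fun a ha => hnd a fun b => ?_⟩
  · exact differentiableAt_sum_smul (F := E →L[ℝ] E →L[ℝ] ℝ) (fun i j => hd (e i) (e j))
      fun i j => (l i).smulRight (l j)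
  · rw [hGp, hGp, hsymm]
  · rw [← hGp]
    exact ha b

end Components

/-! ### Parabolicity descends along local isometries. -/

section Riemannian

variable {E : Type*} [NormedAddCommGroup E] [NormedSpace ℝ E]
  {H : Type*} [TopologicalSpace H] {I : ModelWithCorners ℝ E H} [I.Boundaryless]
  {M : Type*} [TopologicalSpace M] [ChartedSpace H M] [IsManifold I ∞ M]

/-- The coordinate vector fields of a chart are differentiable. -/
theorem contMDiffAt_mfderiv_extChartAt_symm (p : M) (a : E) :
    ContMDiffAt 𝓘(ℝ, E) I.tangent 1
      (fun y => (⟨(extChartAt I p).symm y, mfderiv 𝓘(ℝ, E) I (extChartAt I p).symm y a⟩ :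
        TangentBundle I M)) (extChartAt I p p) := by
  have : IsManifold I 1 M := .of_le (n := ∞) (by simp)
  have : IsManifold I 2 M := .of_le (n := ∞) (WithTop.coe_le_coe.2 le_top)
  have hs : IsOpen (extChartAt I p).target := isOpen_extChartAt_target p
  have hy : extChartAt I p p ∈ (extChartAt I p).target := mem_extChartAt_target p
  have h1 : ContMDiffOn 𝓘(ℝ, E) I 2 (extChartAt I p).symm (extChartAt I p).target :=
    contMDiffOn_extChartAt_symm p
  have hu : UniqueMDiffOn 𝓘(ℝ, E) (extChartAt I p).target := hs.uniqueMDiffOn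
  have h2 := h1.contMDiffOn_tangentMapWithin (m := 1) (by norm_num) hu
  have h3 : ContMDiffAt 𝓘(ℝ, E) 𝓘(ℝ, E).tangent 1
      (fun y => (⟨y, a⟩ : TangentBundle 𝓘(ℝ, E) E)) (extChartAt I p p) :=
    contMDiffAt_vectorSpace_iff_contDiffAt.2 contDiffAt_const
  have h4 : ContMDiffWithinAt 𝓘(ℝ, E) I.tangent 1
      (tangentMapWithin 𝓘(ℝ, E) I (extChartAt I p).symm (extChartAt I p).target ∘
        fun y => (⟨y, a⟩ : TangentBundle 𝓘(ℝ, E) E)) (extChartAt I p).target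
      (extChartAt I p p) :=
    ContMDiffWithinAt.comp (f := fun y => (⟨y, a⟩ : TangentBundle 𝓘(ℝ, E) E)) (extChartAt I p p)
      (h2 ⟨extChartAt I p p, a⟩ hy) h3.contMDiffWithinAt fun y hy => hy
  refine (h4.contMDiffAt (hs.mem_nhds hy)).congr_of_eventuallyEq ?_
  filter_upwards [hs.mem_nhds hy] with y hy'
  exact (tangentMapWithin_eq_tangentMap (p := (⟨y, a⟩ : TangentBundle 𝓘(ℝ, E) E)) (hu y hy')
    (mdifferentiableAt_extChartAt_symm_of_mem hy')).symm

theorem differentiableAt_metricInChart_riemMetric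
    (gM : ContMDiffRiemannianMetric I ∞ E (TangentSpace I : M → Type _)) (p : M) (a b : E) :
    DifferentiableAt ℝ (fun y => metricInChart (riemMetric gM) p y a b) (extChartAt I p p) := by
  have : IsManifold I 1 M := .of_le (n := ∞) (by simp)
  let _ : RiemannianBundle (fun x : M => TangentSpace I x) := ⟨gM.toRiemannianMetric⟩
  have : IsContMDiffRiemannianBundle I 1 E (fun x : M => TangentSpace I x) :=
    ⟨gM.inner, gM.contMDiff.of_le (by simp), fun _ _ _ => rfl⟩
  have h := ContMDiffAt.inner_bundle (F := E) (E := fun x : M => TangentSpace I x)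
    (v := fun y => mfderiv 𝓘(ℝ, E) I (extChartAt I p).symm y a)
    (w := fun y => mfderiv 𝓘(ℝ, E) I (extChartAt I p).symm y b)
    (contMDiffAt_mfderiv_extChartAt_symm (I := I) p a)
    (contMDiffAt_mfderiv_extChartAt_symm (I := I) p b)
  exact (contMDiffAt_iff_contDiffAt.1 h).differentiableAt one_ne_zero

theorem exists_isChartMetric_riemMetric [FiniteDimensional ℝ E]
    (gM : ContMDiffRiemannianMetric I ∞ E (TangentSpace I : M → Type _)) (p : M) :
    ∃ G, IsChartMetric (riemMetric gM) p G := by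
  have : IsManifold I 1 M := .of_le (n := ∞) (by simp)
  refine exists_isChartMetric (riemMetric_bilin gM) (fun a b => gM.symm p a b) (fun a ha => ?_)
    (differentiableAt_metricInChart_riemMetric gM p)
  by_contra hne
  exact (gM.pos p a hne).ne' (ha a)

/-- A Riemannian manifold covered by a parabolic one through a local isometry is parabolic. -/
theorem isParabolic_of_inducedMetric [FiniteDimensional ℝ E] [T2Space M] [ConnectedSpace M]
    (gM : ContMDiffRiemannianMetric I ∞ E (TangentSpace I : M → Type _))
    {H' : Type*} [TopologicalSpace H'] {I' : ModelWithCorners ℝ E H'} [I'.Boundaryless]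
    {S : Type*} [TopologicalSpace S] [ChartedSpace H' S] [IsManifold I' ∞ S] [Nonempty S]
    {φ : S → M} (hφ : ContMDiff I' I ∞ φ) (hinj : ∀ p, Function.Injective (mfderiv I' I φ p))
    (hpar : IsParabolic (inducedMetric I' (riemMetric gM) φ)) : IsParabolic (riemMetric gM) := by
  have : IsManifold I 1 M := .of_le (n := ∞) (by simp)
  have : IsManifold I' 1 S := .of_le (n := ∞) (by simp)
  have : LocallyCompactSpace M := Manifold.locallyCompact_of_finiteDimensional I
  have hφ1 : ContMDiff I' I 1 φ := hφ.of_le (by simp)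
  have hφ2 : ContMDiff I' I 2 φ := hφ.of_le (WithTop.coe_le_coe.2 le_top)
  have hsec := hasLocalSections_of_injective hφ1 hinj
  have hsurj := surjective_of_isCompleteMetric gM hφ1 hsec hpar.complete
  refine ⟨isCompleteMetric_of_surjective (riemMetric_isQuadratic gM) hφ1 hsec hpar.complete
    (eq_of_tendsto_riemDist gM) hsurj, fun f hf hle hbdd => ?_⟩
  obtain ⟨c, hc⟩ := hpar.eq_const (f ∘ φ) (hf.comp hφ2) (fun p => by
    obtain ⟨G, hG⟩ := exists_isChartMetric_riemMetric gM (φ p)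
    rw [hG.laplacian_inducedMetric hφ2 (hinj p) hf]
    exact hle _) (hbdd.mono (range_comp_subset_range φ f))
  refine ⟨c, fun x => ?_⟩
  obtain ⟨p, rfl⟩ := hsurj x
  exact hc p

end Riemannian

/-! ### The plane fronted wave and its parallel field `∂_v`. -/

section WaveGeometry

variable {n : ℕ} {M : Type*} [TopologicalSpace M] [ChartedSpace (EuclideanSpace ℝ (Fin n)) M]

theorem extChartAt_wave_symm (q : (ℝ × ℝ) × M) :
    ⇑(extChartAt (waveModel n) q).symm = Prod.map id (extChartAt (𝓡 n) q.2).symm := by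
  rw [extChartAt_prod]
  ext y <;> simp <;> rfl

theorem extChartAt_wave (q : (ℝ × ℝ) × M) :
    ⇑(extChartAt (waveModel n) q) = Prod.map id (extChartAt (𝓡 n) q.2) := by
  rw [extChartAt_prod]
  ext y <;> simp <;> rfl

variable [IsManifold (𝓡 n) ∞ M]

/-- The differential of the coordinate `u`. -/
def duCLM (n : ℕ) : ((ℝ × ℝ) × EuclideanSpace ℝ (Fin n)) →L[ℝ] ℝ :=
  (ContinuousLinearMap.fst ℝ ℝ ℝ).comp
    (ContinuousLinearMap.fst ℝ (ℝ × ℝ) (EuclideanSpace ℝ (Fin n)))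

variable (gM : ContMDiffRiemannianMetric (𝓡 n) ∞ (EuclideanSpace ℝ (Fin n))
      (TangentSpace (𝓡 n) : M → Type _)) (𝓗 : ℝ × M → ℝ)

theorem waveMetric_apply (q : (ℝ × ℝ) × M) (a b : (ℝ × ℝ) × EuclideanSpace ℝ (Fin n)) :
    waveMetric gM 𝓗 q a b = 𝓗 (q.1.1, q.2) * a.1.1 * b.1.1 + a.1.1 * b.1.2 + a.1.2 * b.1.1
      + riemMetric gM q.2 a.2 b.2 := rfl

theorem riemMetric_zero_left (x : M) (b : EuclideanSpace ℝ (Fin n)) :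
    riemMetric gM x (0 : EuclideanSpace ℝ (Fin n)) b = 0 :=
  congrArg (fun L => L b) ((gM.inner x).map_zero)

theorem riemMetric_zero_right (x : M) (a : EuclideanSpace ℝ (Fin n)) :
    riemMetric gM x a (0 : EuclideanSpace ℝ (Fin n)) = 0 := (gM.inner x a).map_zero

theorem waveMetric_partialV (q : (ℝ × ℝ) × M) (a : (ℝ × ℝ) × EuclideanSpace ℝ (Fin n)) :
    waveMetric gM 𝓗 q a (partialV q) = duCLM n a := by
  refine (waveMetric_apply gM 𝓗 q a ((0, 1), 0)).trans ?_
  simp [riemMetric_zero_right, duCLM]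

theorem waveMetric_bilin (q : (ℝ × ℝ) × M) :
    ∃ B : ((ℝ × ℝ) × EuclideanSpace ℝ (Fin n)) →ₗ[ℝ]
      ((ℝ × ℝ) × EuclideanSpace ℝ (Fin n)) →ₗ[ℝ] ℝ,
      ∀ a b : (ℝ × ℝ) × EuclideanSpace ℝ (Fin n), waveMetric gM 𝓗 q a b = B a b := by
  obtain ⟨B, hB⟩ := riemMetric_bilin gM q.2
  refine ⟨LinearMap.mk₂ ℝ (fun a b : (ℝ × ℝ) × EuclideanSpace ℝ (Fin n) =>
    𝓗 (q.1.1, q.2) * a.1.1 * b.1.1 + a.1.1 * b.1.2 + a.1.2 * b.1.1 + B a.2 b.2) ?_ ?_ ?_ ?_, ?_⟩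
  · intro a a' b
    simp only [Prod.fst_add, Prod.snd_add, map_add, LinearMap.add_apply]
    ring
  · intro r a b
    simp only [Prod.smul_fst, Prod.smul_snd, map_smul, LinearMap.smul_apply, smul_eq_mul]
    ring
  · intro a b b'
    simp only [Prod.fst_add, Prod.snd_add, map_add]
    ring
  · intro r a b
    simp only [Prod.smul_fst, Prod.smul_snd, map_smul, smul_eq_mul]
    ring
  · intro a b
    rw [waveMetric_apply, hB]
    rfl

/-- The components of the metric of a plane fronted wave in a chart. -/
theorem metricInChart_waveMetric (q : (ℝ × ℝ) × M) {y : (ℝ × ℝ) × EuclideanSpace ℝ (Fin n)}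
    (hy : y.2 ∈ (extChartAt (𝓡 n) q.2).target) (a b : (ℝ × ℝ) × EuclideanSpace ℝ (Fin n)) :
    metricInChart (waveMetric gM 𝓗) q y a b =
      𝓗 (y.1.1, (extChartAt (𝓡 n) q.2).symm y.2) * a.1.1 * b.1.1 + a.1.1 * b.1.2
        + a.1.2 * b.1.1 + metricInChart (riemMetric gM) q.2 y.2 a.2 b.2 := by
  have : IsManifold (𝓡 n) 1 M := .of_le (n := ∞) (by simp)
  have hd : MDifferentiableAt 𝓘(ℝ, EuclideanSpace ℝ (Fin n)) (𝓡 n)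
    (extChartAt (𝓡 n) q.2).symm y.2 := mdifferentiableAt_extChartAt_symm_of_mem hy
  have hm : (mfderiv 𝓘(ℝ, (ℝ × ℝ) × EuclideanSpace ℝ (Fin n)) (waveModel n)
      (extChartAt (waveModel n) q).symm y :
        ((ℝ × ℝ) × EuclideanSpace ℝ (Fin n)) →L[ℝ] ((ℝ × ℝ) × EuclideanSpace ℝ (Fin n))) =
      (ContinuousLinearMap.id ℝ (ℝ × ℝ)).prodMap
        (mfderiv 𝓘(ℝ, EuclideanSpace ℝ (Fin n)) (𝓡 n) (extChartAt (𝓡 n) q.2).symm y.2) := by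
    rw [extChartAt_wave_symm, modelWithCornersSelf_prod, ← chartedSpaceSelf_prod]
    refine (mfderiv_prodMap mdifferentiableAt_id hd).trans ?_
    rw [mfderiv_id]
    rfl
  unfold metricInChart
  rw [hm]
  refine (metricField_congr (waveMetric gM 𝓗) (congrFun (extChartAt_wave_symm q) y) _ _).trans ?_
  rfl

variable {𝓗}

theorem differentiableAt_metricInChart_waveMetric
    (h𝓗 : ContMDiff (𝓘(ℝ, ℝ).prod (𝓡 n)) 𝓘(ℝ, ℝ) ∞ 𝓗) (q : (ℝ × ℝ) × M)
    (a b : (ℝ × ℝ) × EuclideanSpace ℝ (Fin n)) :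
    DifferentiableAt ℝ (fun y => metricInChart (waveMetric gM 𝓗) q y a b)
      (extChartAt (waveModel n) q q) := by
  have : IsManifold (𝓡 n) 1 M := .of_le (n := ∞) (by simp)
  have hq : (extChartAt (waveModel n) q q) = (q.1, extChartAt (𝓡 n) q.2 q.2) :=
    congrFun (extChartAt_wave q) q
  rw [hq]
  set z : (ℝ × ℝ) × EuclideanSpace ℝ (Fin n) := (q.1, extChartAt (𝓡 n) q.2 q.2) with hz
  have hev : ∀ᶠ y : (ℝ × ℝ) × EuclideanSpace ℝ (Fin n) in 𝓝 z,
      y.2 ∈ (extChartAt (𝓡 n) q.2).target :=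
    continuous_snd.continuousAt.eventually
      (extChartAt_target_mem_nhds (I := 𝓡 n) q.2 : _ ∈ 𝓝 z.2)
  have h1 : DifferentiableAt ℝ (fun y : (ℝ × ℝ) × EuclideanSpace ℝ (Fin n) =>
      𝓗 (y.1.1, (extChartAt (𝓡 n) q.2).symm y.2)) z := by
    rw [← mdifferentiableAt_iff_differentiableAt]
    refine MDifferentiableAt.comp (I' := 𝓘(ℝ, ℝ).prod (𝓡 n)) z
      (g := 𝓗) (f := fun y : (ℝ × ℝ) × EuclideanSpace ℝ (Fin n) =>
        (y.1.1, (extChartAt (𝓡 n) q.2).symm y.2)) (h𝓗.mdifferentiableAt (by simp)) ?_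
    refine MDifferentiableAt.prodMk ?_ ?_
    · exact (differentiableAt_fst.fst).mdifferentiableAt
    · exact MDifferentiableAt.comp (I' := 𝓘(ℝ, EuclideanSpace ℝ (Fin n))) z
        (g := (extChartAt (𝓡 n) q.2).symm) (f := Prod.snd)
        (mdifferentiableAt_extChartAt_symm_of_mem (mem_extChartAt_target q.2))
        differentiableAt_snd.mdifferentiableAt
  have h2 : DifferentiableAt ℝ (fun y : (ℝ × ℝ) × EuclideanSpace ℝ (Fin n) =>
      metricInChart (riemMetric gM) q.2 y.2 a.2 b.2) z :=
    DifferentiableAt.comp z (g := fun y => metricInChart (riemMetric gM) q.2 y a.2 b.2)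
      (differentiableAt_metricInChart_riemMetric gM q.2 a.2 b.2) differentiableAt_snd
  refine DifferentiableAt.congr_of_eventuallyEq ?_
    (hev.mono fun y hy => metricInChart_waveMetric gM 𝓗 q hy a b)
  exact ((((h1.mul_const _).mul_const _).add_const _).add_const _).add h2

/-- For nondegeneracy, testing against `∂_v` kills the `u`-component, then `∂_u` kills the
`v`-component, and positivity of `gM` kills the rest. -/
theorem exists_isChartMetric_waveMetric (h𝓗 : ContMDiff (𝓘(ℝ, ℝ).prod (𝓡 n)) 𝓘(ℝ, ℝ) ∞ 𝓗)
    (q : (ℝ × ℝ) × M) : ∃ G, IsChartMetric (waveMetric gM 𝓗) q G := by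
  have : IsManifold (𝓡 n) 1 M := .of_le (n := ∞) (by simp)
  refine exists_isChartMetric (waveMetric_bilin gM 𝓗) (fun a b => ?_) (fun a ha => ?_)
    (differentiableAt_metricInChart_waveMetric gM h𝓗 q)
  · rw [waveMetric_apply, waveMetric_apply,
      show riemMetric gM q.2 b.2 a.2 = riemMetric gM q.2 a.2 b.2 from gM.symm q.2 b.2 a.2]
    ring
  · simp only [waveMetric_apply] at ha
    have h1 : a.1.1 = 0 := by
      have := ha ((0, 1), 0)
      simpa [riemMetric_zero_right] using this
    have h2 : a.1.2 = 0 := by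
      have := ha ((1, 0), 0)
      simpa [riemMetric_zero_right, h1] using this
    have h3 : a.2 = 0 := by
      by_contra hne
      have := ha a
      simp only [h1, h2, mul_zero, add_zero, zero_add] at this
      exact (gM.pos q.2 a.2 hne).ne' this
    exact Prod.ext (Prod.ext h1 h2) h3

/-- The field `∂_v` is parallel: `du` annihilates the Christoffel symbols. -/
theorem duCLM_christoffel_waveMetric (h𝓗 : ContMDiff (𝓘(ℝ, ℝ).prod (𝓡 n)) 𝓘(ℝ, ℝ) ∞ 𝓗)
    (q : (ℝ × ℝ) × M) (a b : (ℝ × ℝ) × EuclideanSpace ℝ (Fin n)) :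
    duCLM n (christoffel (waveMetric gM 𝓗) q a b) = 0 := by
  have : IsManifold (𝓡 n) 1 M := .of_le (n := ∞) (by simp)
  obtain ⟨G, hG⟩ := exists_isChartMetric_waveMetric gM h𝓗 q
  set z := extChartAt (waveModel n) q q with hz
  have hz2 : z.2 = extChartAt (𝓡 n) q.2 q.2 :=
    congrArg Prod.snd (congrFun (extChartAt_wave q) q)
  have hzt : z.2 ∈ (extChartAt (𝓡 n) q.2).target := hz2 ▸ mem_extChartAt_target q.2
  set v : (ℝ × ℝ) × EuclideanSpace ℝ (Fin n) := ((0, 1), 0) with hv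
  -- The lowered symbol `Γ(a, b; ∂_v)` consists of three derivatives. Two vanish because `⟨b, ∂_v⟩ =
  -- du(b)` is constant in the chart.
  have hconst : ∀ b c : (ℝ × ℝ) × EuclideanSpace ℝ (Fin n),
      fderiv ℝ (fun y => metricInChart (waveMetric gM 𝓗) q y b v) z c = 0 := by
    intro b c
    have hev : (fun y => metricInChart (waveMetric gM 𝓗) q y b v) =ᶠ[𝓝 z] fun _ => b.1.1 := by
      have : ∀ᶠ y : (ℝ × ℝ) × EuclideanSpace ℝ (Fin n) in 𝓝 z,
          y.2 ∈ (extChartAt (𝓡 n) q.2).target :=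
        continuous_snd.continuousAt.eventually
          ((isOpen_extChartAt_target (I := 𝓡 n) q.2).mem_nhds hzt)
      filter_upwards [this] with y hy
      rw [metricInChart_waveMetric gM 𝓗 q hy]
      have h0 : metricInChart (riemMetric gM) q.2 y.2 b.2 v.2 = 0 := by
        refine (congrArg (riemMetric gM _ _) (map_zero (mfderiv
          𝓘(ℝ, EuclideanSpace ℝ (Fin n)) (𝓡 n) (extChartAt (𝓡 n) q.2).symm y.2))).trans ?_
        exact riemMetric_zero_right gM _ _
      rw [h0]
      simp [hv]
    rw [hev.fderiv_eq]
    simp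
  -- The third vanishes because translation along `∂_v` changes neither `u` nor the point of `M`,
  -- hence no component of the metric.
  have hdir : fderiv ℝ (fun y => metricInChart (waveMetric gM 𝓗) q y a b) z v = 0 := by
    rw [← (differentiableAt_metricInChart_waveMetric gM h𝓗 q a b).lineDeriv_eq_fderiv]
    unfold lineDeriv
    have : (fun t : ℝ => metricInChart (waveMetric gM 𝓗) q (z + t • v) a b) =
        fun _ => metricInChart (waveMetric gM 𝓗) q z a b := by
      funext t
      have h2 : (z + t • v).2 = z.2 := by simp [hv]
      have h1 : (z + t • v).1.1 = z.1.1 := by simp [hv]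
      rw [metricInChart_waveMetric gM 𝓗 q (by rw [h2]; exact hzt),
        metricInChart_waveMetric gM 𝓗 q hzt, h1, h2]
    rw [← hz, this, deriv_const]
  have h1 := hG.apply_christoffel a b v
  unfold christoffelFirst at h1
  rw [← hz, hconst, hconst, hdir, ← hG.eventually_eq.self_of_nhds, metricInChart_self] at h1
  rw [← waveMetric_partialV gM 𝓗 q]
  refine Eq.trans ?_ (h1.trans (by norm_num))
  rw [waveMetric_apply]
  refine (waveMetric_apply gM 𝓗 q (christoffel (waveMetric gM 𝓗) q a b) ((0, 1), 0)).trans ?_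
  simp [hv, riemMetric_zero_left, riemMetric_zero_right]

end WaveGeometry

/-! ### The function `u` along a submanifold. -/

theorem map_metricTrace {E F : Type*} [NormedAddCommGroup E] [NormedSpace ℝ E]
    [FiniteDimensional ℝ E]
    [NormedAddCommGroup F] [NormedSpace ℝ F] (L : F →L[ℝ] ℝ)
    (B : E → E → ℝ) (Q : E → E → F) :
    L (metricTrace B Q) = metricTrace B fun a b => L (Q a b) := by
  simp only [metricTrace, map_sum, map_smul]

theorem fderiv_fderiv_clm_comp {E F : Type*} [NormedAddCommGroup E] [NormedSpace ℝ E]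
    [NormedAddCommGroup F] [NormedSpace ℝ F] (L : F →L[ℝ] ℝ) {f : E → F} {y : E}
    (hf : ContDiffAt ℝ 2 f y) (a b : E) :
    fderiv ℝ (fderiv ℝ (L ∘ f)) y a b = L (fderiv ℝ (fderiv ℝ f) y a b) := by
  have hev : fderiv ℝ (L ∘ f) =ᶠ[𝓝 y] fun x => ContinuousLinearMap.compL ℝ E F ℝ L (fderiv ℝ f x) := by
    filter_upwards [hf.eventually (by simp)] with x hx
    exact (L.hasFDerivAt.comp _ (hx.differentiableAt (by norm_num)).hasFDerivAt).fderiv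
  have hd : HasFDerivAt (fderiv ℝ f) (fderiv ℝ (fderiv ℝ f) y) y :=
    ((hf.fderiv_right (m := 1) (by norm_num)).differentiableAt one_ne_zero).hasFDerivAt
  have h := (ContinuousLinearMap.compL ℝ E F ℝ L).hasFDerivAt.comp y hd
  rw [hev.fderiv_eq, show fderiv ℝ (fun x => ContinuousLinearMap.compL ℝ E F ℝ L (fderiv ℝ f x)) y
    = _ from h.fderiv]
  rfl

section Submanifold

variable {n : ℕ} {M : Type*} [TopologicalSpace M] [ChartedSpace (EuclideanSpace ℝ (Fin n)) M]
  {E : Type*} [NormedAddCommGroup E] [NormedSpace ℝ E]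
  {H : Type*} [TopologicalSpace H] {I : ModelWithCorners ℝ E H}
  {S : Type*} [TopologicalSpace S] [ChartedSpace H S] {ψ : S → (ℝ × ℝ) × M}

/-- In the charts of the wave `u` is linear, so its derivatives along `ψ` are those of `ψ` under
`du`. The factor `c` serves for the signs `1` and `-1` in the two cases of the theorem. -/
theorem writtenInExtChartAt_du (c : ℝ) (p : S) :
    writtenInExtChartAt I 𝓘(ℝ, ℝ) p (fun p => c * (ψ p).1.1) =
      (c • duCLM n) ∘ writtenInExtChartAt I (waveModel n) p ψ := by
  funext y
  simp only [writtenInExtChartAt, Function.comp_apply, extChartAt_wave]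
  rfl

theorem contMDiff_du {m : ℕ∞ω} (hψ : ContMDiff I (waveModel n) m ψ) (c : ℝ) :
    ContMDiff I 𝓘(ℝ, ℝ) m fun p => c * (ψ p).1.1 :=
  (((contDiff_const (c := c)).mul contDiff_fst).contMDiff (n := m)).comp
    (contMDiff_fst.comp hψ)

variable [I.Boundaryless]

theorem mfderiv_du (hψ : ContMDiff I (waveModel n) 1 ψ) (c : ℝ) (p : S) :
    (mfderiv I 𝓘(ℝ, ℝ) (fun p => c * (ψ p).1.1) p : E →L[ℝ] ℝ) =
      (c • duCLM n).comp (mfderiv I (waveModel n) ψ p : E →L[ℝ] _) := by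
  rw [mfderiv_eq_fderiv_writtenInExtChartAt ((contMDiff_du hψ c).mdifferentiableAt one_ne_zero),
    mfderiv_eq_fderiv_writtenInExtChartAt (hψ.mdifferentiableAt one_ne_zero),
    writtenInExtChartAt_du (n := n)]
  exact ((c • duCLM n).hasFDerivAt.comp _ ((contDiffAt_writtenInExtChartAt
    (hψ p)).differentiableAt one_ne_zero).hasFDerivAt).fderiv

variable [IsManifold (𝓡 n) ∞ M]
  (gM : ContMDiffRiemannianMetric (𝓡 n) ∞ (EuclideanSpace ℝ (Fin n))
      (TangentSpace (𝓡 n) : M → Type _)) {𝓗 : ℝ × M → ℝ}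

/-- On a submanifold contained in a null hypersurface `u = u₀`, the induced metric comes from the
projection to `M`. -/
theorem inducedMetric_waveMetric_of_const (hψ : ContMDiff I (waveModel n) 1 ψ) {u₀ : ℝ}
    (hu : ∀ p, (ψ p).1.1 = u₀) :
    inducedMetric I (waveMetric gM 𝓗) ψ = inducedMetric I (riemMetric gM) fun p => (ψ p).2 := by
  funext p a b
  have hdu : ∀ a : E, duCLM n (mfderiv I (waveModel n) ψ p a) = 0 := by
    intro a
    have h1 := mfderiv_du hψ 1 p
    have h2 : (fun p => 1 * (ψ p).1.1) = fun _ : S => u₀ := by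
      funext p
      rw [one_mul, hu]
    rw [h2, one_smul] at h1
    have h3 := congrArg (fun L : E →L[ℝ] ℝ => L a) h1
    refine h3.symm.trans ?_
    exact congrArg (fun L : E →L[ℝ] ℝ => L a) (mfderiv_const (I := I) (I' := 𝓘(ℝ, ℝ)) (x := p))
  have hsnd : ∀ a : E, (mfderiv I (𝓡 n) (fun p => (ψ p).2) p : E →L[ℝ] _) a =
      ((mfderiv I (waveModel n) ψ p : E →L[ℝ] ((ℝ × ℝ) × EuclideanSpace ℝ (Fin n))) a).2 := by
    intro a
    have h := mfderiv_comp p (g := Prod.snd) (f := ψ) (I := I) (I' := waveModel n) (I'' := 𝓡 n)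
      mdifferentiableAt_snd (hψ.mdifferentiableAt one_ne_zero)
    rw [mfderiv_snd] at h
    exact congrArg (fun L : E →L[ℝ] EuclideanSpace ℝ (Fin n) => L a) h
  have ha : ((mfderiv I (waveModel n) ψ p : E →L[ℝ] ((ℝ × ℝ) × EuclideanSpace ℝ (Fin n))) a).1.1
    = 0 := hdu a
  have hb : ((mfderiv I (waveModel n) ψ p : E →L[ℝ] ((ℝ × ℝ) × EuclideanSpace ℝ (Fin n))) b).1.1
    = 0 := hdu b
  refine (waveMetric_apply gM 𝓗 (ψ p) _ _).trans ?_
  rw [ha, hb]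
  unfold inducedMetric
  rw [show mfderiv I (𝓡 n) (fun p => (ψ p).2) p a = _ from hsnd a,
    show mfderiv I (𝓡 n) (fun p => (ψ p).2) p b = _ from hsnd b]
  simp

variable [FiniteDimensional ℝ E]

theorem secondDerivInChart_du (hψ : ContMDiff I (waveModel n) 2 ψ) (c : ℝ) (p : S) (a b : E) :
    secondDerivInChart I 𝓘(ℝ, ℝ) (fun p => c * (ψ p).1.1) p a b =
      c * duCLM n (secondDerivInChart I (waveModel n) ψ p a b) := by
  rw [secondDerivInChart_eq (contMDiff_du hψ c p), secondDerivInChart_eq (hψ p),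
    writtenInExtChartAt_du (n := n)]
  exact fderiv_fderiv_clm_comp (c • duCLM n) (contDiffAt_writtenInExtChartAt (hψ p)) a b

/-- The Hessian of `u` along a submanifold is the `∂_v` component of the second fundamental
form. -/
theorem hessian_du (h𝓗 : ContMDiff (𝓘(ℝ, ℝ).prod (𝓡 n)) 𝓘(ℝ, ℝ) ∞ 𝓗)
    (hψ : ContMDiff I (waveModel n) 2 ψ) (c : ℝ) (p : S) (a b : E) :
    hessian (inducedMetric I (waveMetric gM 𝓗) ψ) (fun p => c * (ψ p).1.1) p a b =
      c * duCLM n (secondFundamentalForm I (waveMetric gM 𝓗) ψ p a b) := by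
  have h1 := secondDerivInChart_du hψ c p a b
  have h2 := mfderiv_du (hψ.of_le (by norm_num)) c p
  set X : E := christoffel (inducedMetric I (waveMetric gM 𝓗) ψ) p a b with hX
  set D : E →L[ℝ] ((ℝ × ℝ) × EuclideanSpace ℝ (Fin n)) := mfderiv I (waveModel n) ψ p with hD
  have h3 : hessian (inducedMetric I (waveMetric gM 𝓗) ψ) (fun p => c * (ψ p).1.1) p a b =
      c * duCLM n (secondDerivInChart I (waveModel n) ψ p a b) - c * duCLM n (D X) := by
    rw [← h1]
    exact congrArg (fun L : E →L[ℝ] ℝ =>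
      secondDerivInChart I 𝓘(ℝ, ℝ) (fun p => c * (ψ p).1.1) p a b - L X) h2
  have h4 : (secondFundamentalForm I (waveMetric gM 𝓗) ψ p a b :
      (ℝ × ℝ) × EuclideanSpace ℝ (Fin n)) = secondDerivInChart I (waveModel n) ψ p a b
        + christoffel (waveMetric gM 𝓗) (ψ p) (D a) (D b) - D X := rfl
  -- The ambient Christoffel term disappears under `du` because `∂_v` is parallel.
  rw [h3, h4, map_sub, map_add, duCLM_christoffel_waveMetric gM h𝓗]
  ring

/-- `Δ(u ∘ ψ) = k ⟨H, ∂_v⟩`. -/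
theorem laplacian_du (h𝓗 : ContMDiff (𝓘(ℝ, ℝ).prod (𝓡 n)) 𝓘(ℝ, ℝ) ∞ 𝓗)
    (hψ : ContMDiff I (waveModel n) 2 ψ) (c : ℝ) (p : S) :
    laplacian (inducedMetric I (waveMetric gM 𝓗) ψ) (fun p => c * (ψ p).1.1) p =
      Module.finrank ℝ E * (c * waveMetric gM 𝓗 (ψ p)
        (meanCurvature I (waveMetric gM 𝓗) ψ p) (partialV (ψ p))) := by
  set T : (ℝ × ℝ) × EuclideanSpace ℝ (Fin n) := metricTrace (E := E)
    (inducedMetric I (waveMetric gM 𝓗) ψ p) (secondFundamentalForm I (waveMetric gM 𝓗) ψ p) with hT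
  have h1 : laplacian (inducedMetric I (waveMetric gM 𝓗) ψ) (fun p => c * (ψ p).1.1) p =
      c * duCLM n T := by
    refine Eq.trans ?_ (map_metricTrace (E := E) (c • duCLM n)
      (inducedMetric I (waveMetric gM 𝓗) ψ p)
      (secondFundamentalForm I (waveMetric gM 𝓗) ψ p)).symm
    unfold laplacian
    congr 1
    funext a b
    exact hessian_du gM h𝓗 hψ c p a b
  have h2 : waveMetric gM 𝓗 (ψ p) (meanCurvature I (waveMetric gM 𝓗) ψ p) (partialV (ψ p)) =
      (1 / (Module.finrank ℝ E : ℝ)) * duCLM n T := by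
    refine (waveMetric_partialV gM 𝓗 (ψ p) _).trans ?_
    exact (duCLM n).map_smul _ T
  rw [h1, h2]
  rcases Nat.eq_zero_or_pos (Module.finrank ℝ E) with h0 | h0
  -- In dimension zero the trace is an empty sum, so both sides are zero.
  · have : IsEmpty (Fin (Module.finrank ℝ E)) := by rw [h0]; infer_instance
    have hT0 : T = 0 := by
      rw [hT]
      exact Fintype.sum_empty _
    rw [hT0, h0]
    simp
  · have : (Module.finrank ℝ E : ℝ) ≠ 0 := by positivity
    field_simp

/-- A wavefront lies in `u = u₀` and projects to `M` by the identity, so it is a copy of `M`. -/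
theorem inducedMetric_wavefront (u₀ v₀ : ℝ) :
    inducedMetric (𝓡 n) (waveMetric gM 𝓗) (wavefront u₀ v₀ : M → (ℝ × ℝ) × M) =
      riemMetric gM := by
  have h : ContMDiff (𝓡 n) (waveModel n) 1 (wavefront u₀ v₀ : M → (ℝ × ℝ) × M) :=
    contMDiff_const.prodMk contMDiff_id
  rw [inducedMetric_waveMetric_of_const gM h (u₀ := u₀) fun _ => rfl]
  funext x a b
  unfold inducedMetric
  have : mfderiv (𝓡 n) (𝓡 n) (fun p : M => (wavefront u₀ v₀ p).2) x =
    ContinuousLinearMap.id ℝ _ := mfderiv_id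
  rw [this]
  rfl

end Submanifold

end PlaneFrontedWave

end

/-! ### The main theorem. -/

open PlaneFrontedWave in
theorem mainTheorem5 {n k : ℕ}
    {M : Type*} [TopologicalSpace M] [ChartedSpace (EuclideanSpace ℝ (Fin n)) M]
    [IsManifold (𝓡 n) ∞ M] [T2Space M] [SecondCountableTopology M] [ConnectedSpace M]
    (gM : ContMDiffRiemannianMetric (𝓡 n) ∞ (EuclideanSpace ℝ (Fin n))
      (TangentSpace (𝓡 n) : M → Type _))
    (𝓗 : ℝ × M → ℝ) (h𝓗 : ContMDiff (𝓘(ℝ, ℝ).prod (𝓡 n)) 𝓘(ℝ, ℝ) ∞ 𝓗)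
    {S : Type*} [TopologicalSpace S] [ChartedSpace (EuclideanSpace ℝ (Fin k)) S]
    [IsManifold (𝓡 k) ∞ S] [T2Space S] [SecondCountableTopology S] [ConnectedSpace S]
    (ψ : S → (ℝ × ℝ) × M)
    (hψ : IsSpacelikeSubmanifold (𝓡 k) (waveMetric gM 𝓗) ψ)
    (hpar : IsParabolic (inducedMetric (𝓡 k) (waveMetric gM 𝓗) ψ))
    (hH :
      ((∀ p, 0 ≤ waveMetric gM 𝓗 (ψ p)
            (meanCurvature (𝓡 k) (waveMetric gM 𝓗) ψ p) (partialV (ψ p))) ∧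
        BddAbove (range fun p => (ψ p).1.1)) ∨
      ((∀ p, waveMetric gM 𝓗 (ψ p)
            (meanCurvature (𝓡 k) (waveMetric gM 𝓗) ψ p) (partialV (ψ p)) ≤ 0) ∧
        BddBelow (range fun p => (ψ p).1.1))) :
    ∃ u₀ : ℝ, (∀ p, (ψ p).1.1 = u₀) ∧
      (k = n → SimplyConnectedSpace S →
        ∀ v₀ : ℝ, IsParabolic (inducedMetric (𝓡 n) (waveMetric gM 𝓗)
          (wavefront u₀ v₀ : M → (ℝ × ℝ) × M))) := by
  have hψ1 : ContMDiff (𝓡 k) (waveModel n) 1 ψ := hψ.contMDiff.of_le (by simp)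
  have hψ2 : ContMDiff (𝓡 k) (waveModel n) 2 ψ :=
    hψ.contMDiff.of_le (WithTop.coe_le_coe.2 le_top)
  have hconst : ∃ u₀ : ℝ, ∀ p, (ψ p).1.1 = u₀ := by
    rcases hH with ⟨hH, B, hB⟩ | ⟨hH, B, hB⟩
    · obtain ⟨c, hc⟩ := hpar.eq_const (fun p => -1 * (ψ p).1.1) (contMDiff_du hψ2 (-1))
        (fun p => by
          rw [laplacian_du gM h𝓗 hψ2]
          exact mul_nonpos_of_nonneg_of_nonpos (Nat.cast_nonneg _) (by linarith [hH p]))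
        ⟨-B, by
          rintro _ ⟨p, rfl⟩
          have := hB ⟨p, rfl⟩
          dsimp only at this ⊢
          linarith⟩
      exact ⟨-c, fun p => by linarith [hc p]⟩
    · obtain ⟨c, hc⟩ := hpar.eq_const (fun p => 1 * (ψ p).1.1) (contMDiff_du hψ2 1)
        (fun p => by
          rw [laplacian_du gM h𝓗 hψ2]
          exact mul_nonpos_of_nonneg_of_nonpos (Nat.cast_nonneg _) (by linarith [hH p]))
        ⟨B, by
          rintro _ ⟨p, rfl⟩
          have := hB ⟨p, rfl⟩
          dsimp only at this ⊢
          linarith⟩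
      exact ⟨c, fun p => by linarith [hc p]⟩
  obtain ⟨u₀, hu⟩ := hconst
  refine ⟨u₀, hu, ?_⟩
  rintro rfl - v₀
  rw [inducedMetric_wavefront]
  have hind := inducedMetric_waveMetric_of_const gM (𝓗 := 𝓗) hψ1 hu
  have hφ : ContMDiff (𝓡 k) (𝓡 k) ∞ fun p => (ψ p).2 := contMDiff_snd.comp hψ.contMDiff
  refine isParabolic_of_inducedMetric gM hφ (fun p => ?_) (hind ▸ hpar)
  -- A nonzero vector killed by the projection to `M` would be null for the induced metric, which is
  -- Riemannian.
  refine (injective_iff_map_eq_zero _).2 fun a ha => ?_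
  by_contra hne
  have hpos := hψ.spacelike p a hne
  rw [hind] at hpos
  unfold inducedMetric at hpos
  rw [ha] at hpos
  exact hpos.ne' (riemMetric_zero_right gM _ _)
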